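/- Let $d\ge 1$ and let $K:\mathbb{R}^d\to[-\infty,\infty]$ be either $K(x)=\frac{1}{p}|x|^p$ with $-d<p<0$, or $K(x)=\frac1q|x|^q-\frac1p|x|^p$ with $-d<p<0<q$. Let $\mathcal P(\mathbb{R}^d)$ be the set of Borel probability measures on $\mathbb{R}^d$, and let $\mathcal P_2(\mathbb{R}^d)$ be the set of those with finite second moment. For $m>1$ and $\rho\in\mathcal P(\mathbb{R}^d)$, define $$\mathsf E_m(\rho)=\frac12\iint K(x-y)\,\rho(x)\rho(y)\,dx\,dy+\frac1{m-1}\int\rho(x)^m\,dx$$ if $\rho$ is absolutely continuous with respect to Lebesgue measure with density (also denoted $\rho$) in $L^m(\mathbb{R}^d)$, and $\mathsf E_m(\rho)=+\infty$ otherwise. Then there exist $R>0$ and $m_0>1$, depending only on $d$ and $K$, such that for every real $m\ge m_0$ and every minimizer $\rho_m$ of $\mathsf E_m$, over $\mathcal P_2(\mathbb{R}^d)$ or over $\mathcal P(\mathbb{R}^d)$, some translate of $\rho_m$ has its support contained in $B_R(0)$: there is $a\in\mathbb{R}^d$ such that the pushforward of $\rho_m$ under $x\mapsto x-a$ is supported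 in $B_R(0)$. -/

import Mathlib

open MeasureTheory
open scoped ENNReal

noncomputable section

/-- The attractive power-law potential `K(x) = |x|^p / p` on `ℝ^d`. (For `p < 0` its value at the
single point `x = 0` is irrelevant below: the energy is only evaluated on measures with a
density.) -/
def attractivePotential (d : ℕ) (p : ℝ) (x : EuclideanSpace ℝ (Fin d)) : ℝ :=
  ‖x‖ ^ p / p

/-- The repulsive-attractive power-law potential `K(x) = |x|^q / q - |x|^p / p` on `ℝ^d`. -/
def repulsiveAttractivePotential (d : ℕ) (p q : ℝ) (x : EuclideanSpace ℝ (Fin d)) : ℝ :=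
  ‖x‖ ^ q / q - ‖x‖ ^ p / p

/-- The interaction energy `(1/2) ∬ K(x - y) dμ(x) dμ(y)`, with values in `[-∞, ∞]`, as the
integral of the positive part minus the integral of the negative part of `K`. For the potentials
above one of the two parts vanishes, so that no `∞ - ∞` occurs. -/
def interactionEnergy {d : ℕ} (K : EuclideanSpace ℝ (Fin d) → ℝ)
    (μ : Measure (EuclideanSpace ℝ (Fin d))) : EReal :=
  ((2⁻¹ * ∫⁻ x, ∫⁻ y, ENNReal.ofReal (K (x - y)) ∂μ ∂μ : ℝ≥0∞) : EReal) -
    ((2⁻¹ * ∫⁻ x, ∫⁻ y, ENNReal.ofReal (-K (x - y)) ∂μ ∂μ : ℝ≥0∞) : EReal)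

/-- The Rényi entropy `(1/(m-1)) ∫ ρ(x)^m dx`, where `ρ` is the Lebesgue density of `μ`. -/
def renyiEntropy {d : ℕ} (m : ℝ) (μ : Measure (EuclideanSpace ℝ (Fin d))) : ℝ≥0∞ :=
  ENNReal.ofReal (1 / (m - 1)) * ∫⁻ x, μ.rnDeriv volume x ^ m

open Classical in
/-- The aggregation-diffusion energy `E_m` with interaction potential `K`: interaction energy plus
Rényi entropy if `μ` is absolutely continuous with a density in `L^m(ℝ^d)`, and `+∞` otherwise. -/
def energy {d : ℕ} (K : EuclideanSpace ℝ (Fin d) → ℝ) (m : ℝ)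
    (μ : Measure (EuclideanSpace ℝ (Fin d))) : EReal :=
  if μ ≪ volume ∧ MemLp (fun x => (μ.rnDeriv volume x).toReal) (ENNReal.ofReal m) volume then
    interactionEnergy K μ + (renyiEntropy m μ : EReal)
  else ⊤

/-- `P₂(ℝ^d)`: the Borel probability measures on `ℝ^d` with finite second moment. -/
def finiteSecondMoment (d : ℕ) : Set (ProbabilityMeasure (EuclideanSpace ℝ (Fin d))) :=
  {μ | ∫⁻ x, ‖x‖ₑ ^ 2 ∂(μ : Measure (EuclideanSpace ℝ (Fin d))) < ∞}

/-- `μ` is a minimizer of `E_m` over the class `𝒜` of probability measures. -/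
def IsEnergyMinimizer {d : ℕ} (K : EuclideanSpace ℝ (Fin d) → ℝ) (m : ℝ)
    (𝒜 : Set (ProbabilityMeasure (EuclideanSpace ℝ (Fin d))))
    (μ : ProbabilityMeasure (EuclideanSpace ℝ (Fin d))) : Prop :=
  μ ∈ 𝒜 ∧ ∀ ν ∈ 𝒜, energy K m μ ≤ energy K m ν

end

/-!
Dilating a minimizer `ρ` of the energy gives a virial identity relating its entropy to its
interaction energy, and removing a small part of its mass gives a one-sided Euler–Lagrange
inequality for the potential `K * ρ` at almost every point.

In the repulsive-attractive case these two facts bound `|x|^q * ρ` at almost every point, uniformly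
in `m`, and two points where it is bounded cannot be far apart. In the attractive case they bound
`|x|^p * ρ` from below, and Young's inequality shows that only a vanishing part of this potential
comes from very short distances. Hence every ball of some fixed radius `r` around almost every point
carries mass at least some fixed `δ`. Moreover the support cannot be separated by an empty slab,
since moving one of the two pieces towards the other would keep the entropy and lower the
interaction energy. So every slab of width `3 * r` between two points of the support has mass at
least `δ`, which bounds the number of such slabs and thereby the diameter.
-/

open Filter Topology Metric

section DensityPower

variable {α β : Type*} [MeasurableSpace α] [MeasurableSpace β] {μ μ₁ μ₂ ν : Measure α} {m : ℝ}

/-- The integral `∫ ρ ^ m dν` of a power of the density `ρ` of `μ` with respect to `ν`. -/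
noncomputable def densityPower (m : ℝ) (μ ν : Measure α) : ℝ≥0∞ :=
  ∫⁻ x, μ.rnDeriv ν x ^ m ∂ν

theorem memLp_toReal_rnDeriv_iff [SigmaFinite μ] (hm : 0 < m) :
    MemLp (fun x => (μ.rnDeriv ν x).toReal) (ENNReal.ofReal m) ν ↔ densityPower m μ ν ≠ ∞ := by
  have h_meas : AEStronglyMeasurable (fun x => (μ.rnDeriv ν x).toReal) ν :=
    (Measure.measurable_rnDeriv μ ν).ennreal_toReal.aestronglyMeasurable
  have h_lintegral : ∫⁻ x, ‖(μ.rnDeriv ν x).toReal‖ₑ ^ m ∂ν = densityPower m μ ν := by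
    refine lintegral_congr_ae ?_
    filter_upwards [Measure.rnDeriv_lt_top μ ν] with x hx
    rw [Real.enorm_eq_ofReal ENNReal.toReal_nonneg, ENNReal.ofReal_toReal hx.ne]
  rw [MemLp, and_iff_right h_meas, eLpNorm_lt_top_iff_lintegral_rpow_enorm_lt_top (by simpa)
    ENNReal.ofReal_ne_top, ENNReal.toReal_ofReal hm.le, h_lintegral, lt_top_iff_ne_top]

theorem rnDeriv_le_of_le_smul [SigmaFinite μ₁] [SigmaFinite ν] {C : ℝ≥0∞} (hμ₁ : μ₁ ≪ ν)
    (h : μ₂ ≤ C • μ₁) : μ₂.rnDeriv ν ≤ᵐ[ν] fun x => C * μ₁.rnDeriv ν x := by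
  refine ae_le_of_forall_setLIntegral_le_of_sigmaFinite (Measure.measurable_rnDeriv μ₂ ν)
    fun s _ _ => ?_
  rw [lintegral_const_mul _ (Measure.measurable_rnDeriv μ₁ ν), Measure.setLIntegral_rnDeriv hμ₁]
  exact (Measure.setLIntegral_rnDeriv_le s).trans (h s)

theorem densityPower_le_of_le_smul [SigmaFinite μ₁] [SigmaFinite ν] {C : ℝ≥0∞} (hμ₁ : μ₁ ≪ ν)
    (h : μ₂ ≤ C • μ₁) (hm : 0 ≤ m) : densityPower m μ₂ ν ≤ C ^ m * densityPower m μ₁ ν := by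
  rw [densityPower, densityPower,
    ← lintegral_const_mul _ ((Measure.measurable_rnDeriv μ₁ ν).pow_const m)]
  refine lintegral_mono_ae ?_
  filter_upwards [rnDeriv_le_of_le_smul hμ₁ h] with x hx
  rw [← ENNReal.mul_rpow_of_nonneg _ _ hm]
  exact ENNReal.rpow_le_rpow hx hm

theorem densityPower_le_measure_univ [SigmaFinite ν] (h : μ ≤ ν) (hm : 1 ≤ m) :
    densityPower m μ ν ≤ μ Set.univ := by
  refine le_trans (lintegral_mono_ae ?_) Measure.lintegral_rnDeriv_le
  filter_upwards [Measure.rnDeriv_le_one_of_le h] with x hx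
  simpa using ENNReal.rpow_le_rpow_of_exponent_ge hx hm

theorem densityPower_add_of_mutuallySingular [SigmaFinite μ₁] [SigmaFinite μ₂] [SigmaFinite ν]
    (hm : 0 < m) (h : μ₁ ⟂ₘ μ₂) :
    densityPower m (μ₁ + μ₂) ν = densityPower m μ₁ ν + densityPower m μ₂ ν := by
  obtain ⟨s, hs, h₁, h₂⟩ := h
  have rnDeriv_eq_zero {τ : Measure α} {t : Set α} (ht : MeasurableSet t) (hτ : τ t = 0) :
      ∀ᵐ x ∂ν, x ∈ t → τ.rnDeriv ν x = 0 := by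
    refine (ae_restrict_iff' ht).1 ((lintegral_eq_zero_iff (Measure.measurable_rnDeriv τ ν)).1 ?_)
    exact le_antisymm ((Measure.setLIntegral_rnDeriv_le t).trans hτ.le) zero_le
  rw [densityPower, densityPower, densityPower,
    ← lintegral_add_left ((Measure.measurable_rnDeriv μ₁ ν).pow_const m)]
  refine lintegral_congr_ae ?_
  filter_upwards [Measure.rnDeriv_add' μ₁ μ₂ ν, rnDeriv_eq_zero hs h₁,
    rnDeriv_eq_zero hs.compl h₂] with x hx hx₁ hx₂
  rw [hx, Pi.add_apply]
  by_cases hxs : x ∈ s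
  · simp [hx₁ hxs, hm]
  · simp [hx₂ hxs, hm]

theorem densityPower_map_map [SigmaFinite μ] [SigmaFinite ν] {f : α → β}
    (hf : MeasurableEmbedding f) : densityPower m (μ.map f) (ν.map f) = densityPower m μ ν := by
  rw [densityPower, hf.lintegral_map]
  refine lintegral_congr_ae ?_
  filter_upwards [hf.rnDeriv_map μ ν] with x hx
  rw [hx]

theorem densityPower_smul_right [SigmaFinite μ] [SigmaFinite ν] {c : ℝ≥0∞} (hc : c ≠ 0)
    (hc' : c ≠ ∞) (hm : 0 ≤ m) : densityPower m μ (c • ν) = c ^ (1 - m) * densityPower m μ ν := by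
  rw [densityPower, lintegral_smul_measure, smul_eq_mul, densityPower, sub_eq_add_neg,
    ENNReal.rpow_add _ _ hc hc', ENNReal.rpow_one, mul_assoc, ENNReal.rpow_neg, ← ENNReal.inv_rpow,
    ← lintegral_const_mul _ ((Measure.measurable_rnDeriv μ ν).pow_const m)]
  congr 1
  refine lintegral_congr_ae ?_
  filter_upwards [Measure.rnDeriv_smul_right_of_ne_top' μ ν hc hc'] with x hx
  rw [hx, Pi.smul_apply, smul_eq_mul, ENNReal.mul_rpow_of_nonneg _ _ hm]

end DensityPower

section DensityPowerHaar

variable {E : Type*} [NormedAddCommGroup E] [NormedSpace ℝ E] [FiniteDimensional ℝ E]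
  [MeasurableSpace E] [BorelSpace E] {μ ν : Measure E} [SigmaFinite μ] [ν.IsAddHaarMeasure] {m : ℝ}

theorem densityPower_map_add_right (a : E) :
    densityPower m (μ.map (· + a)) ν = densityPower m μ ν := by
  conv_lhs => rw [← map_add_right_eq_self ν a]
  exact densityPower_map_map (MeasurableEquiv.addRight a).measurableEmbedding

theorem densityPower_map_smul (hm : 0 ≤ m) {t : ℝ} (ht : 0 < t) :
    densityPower m (μ.map (t • ·)) ν =
      ENNReal.ofReal (t ^ (-(Module.finrank ℝ E * (m - 1)))) * densityPower m μ ν := by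
  have h_emb : MeasurableEmbedding (fun x : E => t • x) :=
    (Homeomorph.smulOfNeZero t ht.ne').measurableEmbedding
  set c := ENNReal.ofReal (t ^ (Module.finrank ℝ E : ℝ)) with hc
  have hc₀ : c ≠ 0 := by simpa [hc] using by positivity
  have hν : ν = c • ν.map (t • ·) := by
    rw [Measure.map_addHaar_smul ν ht.ne', smul_smul, hc, ← ENNReal.ofReal_mul (by positivity),
      Real.rpow_natCast, abs_of_pos (by positivity), mul_inv_cancel₀ (by positivity),
      ENNReal.ofReal_one, one_smul]
  have : SigmaFinite (ν.map (t • ·)) := h_emb.sigmaFinite_map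
  have : SigmaFinite (μ.map (t • ·)) := h_emb.sigmaFinite_map
  conv_lhs => rw [hν]
  rw [densityPower_smul_right hc₀ ENNReal.ofReal_ne_top hm, densityPower_map_map h_emb, hc,
    ENNReal.ofReal_rpow_of_pos (by positivity), ← Real.rpow_mul ht.le]
  ring_nf

end DensityPowerHaar

section MutualInteraction

variable {G : Type*} [MeasurableSpace G] [AddGroup G] {k k₁ k₂ : G → ℝ≥0∞}
  {μ μ₁ μ₂ ν ν₁ ν₂ : Measure G}

/-- The mutual interaction `∬ k (x - y) dν(y) dμ(x)` of two measures through a nonnegative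
kernel. -/
noncomputable def mutualInteraction (k : G → ℝ≥0∞) (μ ν : Measure G) : ℝ≥0∞ :=
  ∫⁻ x, ∫⁻ y, k (x - y) ∂ν ∂μ

theorem mutualInteraction_mono (hμ : μ₁ ≤ μ₂) (hν : ν₁ ≤ ν₂) :
    mutualInteraction k μ₁ ν₁ ≤ mutualInteraction k μ₂ ν₂ :=
  lintegral_mono' hμ fun _ => lintegral_mono' hν le_rfl

theorem mutualInteraction_add_left :
    mutualInteraction k (μ₁ + μ₂) ν = mutualInteraction k μ₁ ν + mutualInteraction k μ₂ ν :=
  lintegral_add_measure _ _ _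

theorem mutualInteraction_smul_left (c : ℝ≥0∞) :
    mutualInteraction k (c • μ) ν = c * mutualInteraction k μ ν :=
  lintegral_smul_measure _ _

theorem mutualInteraction_smul_kernel {c : ℝ≥0∞} (hc : c ≠ ∞) :
    mutualInteraction (c • k) μ ν = c * mutualInteraction k μ ν := by
  simp only [mutualInteraction, Pi.smul_apply, smul_eq_mul, lintegral_const_mul' _ _ hc]

theorem mutualInteraction_smul_right {c : ℝ≥0∞} (hc : c ≠ ∞) :
    mutualInteraction k μ (c • ν) = c * mutualInteraction k μ ν := by
  simp only [mutualInteraction, lintegral_smul_measure, smul_eq_mul, lintegral_const_mul' _ _ hc]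

theorem mutualInteraction_smul_self {c : ℝ≥0∞} (hc : c ≠ ∞) :
    mutualInteraction k (c • μ) (c • μ) = c ^ 2 * mutualInteraction k μ μ := by
  rw [mutualInteraction_smul_left, mutualInteraction_smul_right hc, sq, mul_assoc]

variable [MeasurableSub₂ G]

theorem measurable_lintegral_sub [SFinite ν] (hk : Measurable k) :
    Measurable fun x => ∫⁻ y, k (x - y) ∂ν :=
  (hk.comp measurable_sub).lintegral_prod_right'

theorem mutualInteraction_add_kernel [SFinite ν] (hk₁ : Measurable k₁) :
    mutualInteraction (k₁ + k₂) μ ν = mutualInteraction k₁ μ ν + mutualInteraction k₂ μ ν := by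
  rw [mutualInteraction, mutualInteraction, mutualInteraction,
    ← lintegral_add_left (measurable_lintegral_sub hk₁)]
  refine lintegral_congr fun x => ?_
  exact lintegral_add_left (hk₁.comp (measurable_id.const_sub x)) _

theorem mutualInteraction_map [SFinite ν] (hk : Measurable k) {f g : G → G} (hf : Measurable f)
    (hg : Measurable g) : mutualInteraction k (μ.map f) (ν.map g) =
      ∫⁻ x, ∫⁻ y, k (f x - g y) ∂ν ∂μ := by
  rw [mutualInteraction, lintegral_map (measurable_lintegral_sub hk) hf]
  exact lintegral_congr fun x => lintegral_map (hk.comp (measurable_const.sub measurable_id)) hg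

theorem mutualInteraction_comm [SFinite μ] [SFinite ν] (hk : Measurable k) (hk_even : k.Even) :
    mutualInteraction k μ ν = mutualInteraction k ν μ := by
  have h_meas : Measurable fun z : G × G => k (z.1 - z.2) := hk.comp measurable_sub
  rw [mutualInteraction, lintegral_lintegral_swap h_meas.aemeasurable]
  exact lintegral_congr fun x => lintegral_congr fun y => by rw [← hk_even, neg_sub]

theorem mutualInteraction_add_self [SFinite μ₁] [SFinite μ₂] (hk : Measurable k)
    (hk_even : k.Even) : mutualInteraction k (μ₁ + μ₂) (μ₁ + μ₂) =
      mutualInteraction k μ₁ μ₁ + mutualInteraction k μ₂ μ₂ + 2 * mutualInteraction k μ₁ μ₂ := by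
  simp only [mutualInteraction_add_left, mutualInteraction_comm hk hk_even (ν := μ₁ + μ₂)]
  rw [mutualInteraction_comm hk hk_even (μ := μ₂) (ν := μ₁)]
  ring

theorem toReal_mutualInteraction_self_of_add_smul_eq {η τ : Measure G} [SFinite η] [SFinite τ]
    {s : NNReal} (hk : Measurable k) (hk_even : k.Even) (h_add : η + (s : ℝ≥0∞) • τ = μ)
    (hτ : τ ≤ μ) (hV : mutualInteraction k μ μ ≠ ∞) :
    (mutualInteraction k η η).toReal = (mutualInteraction k μ μ).toReal -
      2 * s * (mutualInteraction k τ μ).toReal + s ^ 2 * (mutualInteraction k τ τ).toReal := by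
  have hη : η ≤ μ := h_add ▸ Measure.le_add_right le_rfl
  have h_self : mutualInteraction k μ μ = mutualInteraction k η η +
      (s : ℝ≥0∞) ^ 2 * mutualInteraction k τ τ + 2 * (s * mutualInteraction k τ η) := by
    rw [← h_add, mutualInteraction_add_self hk hk_even, mutualInteraction_smul_self
      ENNReal.coe_ne_top, mutualInteraction_smul_right ENNReal.coe_ne_top,
      mutualInteraction_comm hk hk_even (μ := τ) (ν := η)]
  have h_mixed : mutualInteraction k τ μ =
      mutualInteraction k τ η + s * mutualInteraction k τ τ := by
    rw [← h_add, mutualInteraction_comm hk hk_even, mutualInteraction_add_left,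
      mutualInteraction_smul_left, mutualInteraction_comm hk hk_even (ν := τ)]
  have h_ne_top {μ₁ μ₂ : Measure G} (h₁ : μ₁ ≤ μ) (h₂ : μ₂ ≤ μ) :
      mutualInteraction k μ₁ μ₂ ≠ ∞ := ne_top_of_le_ne_top hV (mutualInteraction_mono h₁ h₂)
  rw [h_self, h_mixed]
  lift mutualInteraction k η η to NNReal using h_ne_top hη hη with Vηη
  lift mutualInteraction k τ η to NNReal using h_ne_top hτ hη with Vτη
  lift mutualInteraction k τ τ to NNReal using h_ne_top hτ hτ with Vττ
  rw [ENNReal.toReal_add (by finiteness) (by finiteness),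
    ENNReal.toReal_add (by finiteness) (by finiteness),
    ENNReal.toReal_add (by finiteness) (by finiteness)]
  simp only [ENNReal.toReal_mul, ENNReal.toReal_pow, ENNReal.toReal_ofNat, ENNReal.coe_toReal]
  ring

end MutualInteraction

theorem nonneg_of_hasDerivAt_of_le {f : ℝ → ℝ} {f' : ℝ} (hf : HasDerivAt f f' 0)
    (hle : ∀ s ∈ Set.Ioo 0 1, f 0 ≤ f s) : 0 ≤ f' := by
  refine ge_of_tendsto hf.tendsto_slope_zero_right ?_
  filter_upwards [Ioo_mem_nhdsGT one_pos] with s hs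
  rw [zero_add, smul_eq_mul]
  exact mul_nonneg (inv_nonneg.2 hs.1.le) (sub_nonneg.2 (hle s hs))

theorem isProbabilityMeasure_inv_smul_sub {α : Type*} [MeasurableSpace α] {μ τ : Measure α}
    [IsProbabilityMeasure μ] (hτ : τ ≤ μ) (hτ_univ : τ Set.univ < 1) :
    IsProbabilityMeasure ((1 - τ Set.univ)⁻¹ • (μ - τ)) := by
  have : IsFiniteMeasure τ := isFiniteMeasure_of_le μ hτ
  constructor
  rw [Measure.smul_apply, Measure.sub_apply .univ hτ, measure_univ (μ := μ), smul_eq_mul,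
    ENNReal.inv_mul_cancel (tsub_pos_of_lt hτ_univ).ne' (by finiteness)]

section Homogeneous

variable {E : Type*} [AddCommGroup E] [Module ℝ E] {k : E → ℝ≥0∞} {s t : ℝ}

/-- Positive homogeneity of degree `s` of an extended nonnegative kernel. -/
def IsHomogeneousKernel (s : ℝ) (k : E → ℝ≥0∞) : Prop :=
  ∀ ⦃t : ℝ⦄, 0 < t → ∀ x, k (t • x) = ENNReal.ofReal (t ^ s) * k x

theorem IsHomogeneousKernel.const_smul (hs : IsHomogeneousKernel s k) (c : ℝ≥0∞) :
    IsHomogeneousKernel s (c • k) := fun t ht x => by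
  rw [Pi.smul_apply, Pi.smul_apply, hs ht, mul_smul_comm]

theorem mutualInteraction_map_smul [MeasurableSpace E] [MeasurableSub₂ E]
    [MeasurableConstSMul ℝ E] {μ : Measure E} [SFinite μ] (hk : Measurable k)
    (hs : IsHomogeneousKernel s k) (ht : 0 < t) :
    mutualInteraction k (μ.map (t • ·)) (μ.map (t • ·)) =
      ENNReal.ofReal (t ^ s) * mutualInteraction k μ μ := by
  rw [mutualInteraction_map hk (measurable_const_smul t) (measurable_const_smul t)]
  simp only [← smul_sub, hs ht, lintegral_const_mul' _ _ ENNReal.ofReal_ne_top, mutualInteraction]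

end Homogeneous

section Minimizer

variable {E : Type*} [NormedAddCommGroup E] [InnerProductSpace ℝ E] [FiniteDimensional ℝ E]
  [MeasurableSpace E] [BorelSpace E] {k : E → ℝ≥0∞} {σ m : ℝ} {μ τ : Measure E}

/-- The aggregation-diffusion energy with interaction potential `σ * k`, as a real number. It
agrees with the extended-real energy on measures for which both of its parts are finite. -/
noncomputable def realEnergy (k : E → ℝ≥0∞) (σ m : ℝ) (μ : Measure E) : ℝ :=
  σ / 2 * (mutualInteraction k μ μ).toReal + (densityPower m μ volume).toReal / (m - 1)

/-- `μ` has finite interaction and entropy and minimizes the energy among all such probability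
measures `ν`. Comparison with measures of infinite second moment is demanded only if `μ` itself
has infinite second moment, so that minimizers over `𝒫` and over `𝒫₂` are both covered. -/
structure IsRegularMinimizer (k : E → ℝ≥0∞) (σ m : ℝ) (μ : Measure E) : Prop where
  absolutelyContinuous : μ ≪ volume
  densityPower_ne_top : densityPower m μ volume ≠ ∞
  interaction_ne_top : mutualInteraction k μ μ ≠ ∞
  realEnergy_le (ν : Measure E) [IsProbabilityMeasure ν] (hmem : MemLp id 2 μ → MemLp id 2 ν)
    (hν : ν ≪ volume) (hF : densityPower m ν volume ≠ ∞) (hV : mutualInteraction k ν ν ≠ ∞) :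
    realEnergy k σ m μ ≤ realEnergy k σ m ν

namespace IsRegularMinimizer

variable [IsProbabilityMeasure μ]

theorem realEnergy_le_of_smul (h : IsRegularMinimizer k σ m μ) (hm : 1 < m) {η : Measure E}
    (hη : η ≤ μ) {c : ℝ≥0∞} (hc : c ≠ ∞) [IsProbabilityMeasure (c • η)] :
    realEnergy k σ m μ ≤ σ / 2 * (c.toReal ^ 2 * (mutualInteraction k η η).toReal) +
      c.toReal ^ m * (densityPower m μ volume).toReal / (m - 1) := by
  have h_le : c • η ≤ c • μ := by gcongr
  have hF := densityPower_le_of_le_smul h.absolutelyContinuous h_le (zero_lt_one.trans hm).le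
  have hF_ne_top : c ^ m * densityPower m μ volume ≠ ∞ :=
    ENNReal.mul_ne_top (ENNReal.rpow_ne_top_of_nonneg (by linarith) hc) h.densityPower_ne_top
  have hV : mutualInteraction k η η ≠ ∞ :=
    ne_top_of_le_ne_top h.interaction_ne_top (mutualInteraction_mono hη hη)
  refine (h.realEnergy_le (c • η) (fun hmem => hmem.of_measure_le_smul hc h_le)
    ((Measure.absolutelyContinuous_of_le_smul h_le).trans h.absolutelyContinuous)
    (ne_top_of_le_ne_top hF_ne_top hF)
    (by rw [mutualInteraction_smul_self hc]; finiteness)).trans ?_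
  rw [realEnergy, mutualInteraction_smul_self hc, ENNReal.toReal_mul, ENNReal.toReal_pow]
  gcongr
  rw [ENNReal.toReal_rpow, ← ENNReal.toReal_mul]
  exact ENNReal.toReal_mono hF_ne_top hF

theorem realEnergy_le_of_le (h : IsRegularMinimizer k σ m μ) (hm : 1 < m) (hk : Measurable k)
    (hk_even : k.Even) (hτ : τ ≤ μ) {s : NNReal} (hs : s < 1) :
    realEnergy k σ m μ ≤ σ / 2 * ((1 - s * τ.real Set.univ)⁻¹ ^ 2 *
      ((mutualInteraction k μ μ).toReal - 2 * s * (mutualInteraction k τ μ).toReal +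
        s ^ 2 * (mutualInteraction k τ τ).toReal)) +
      (1 - s * τ.real Set.univ)⁻¹ ^ m * (densityPower m μ volume).toReal / (m - 1) := by
  have : IsFiniteMeasure τ := isFiniteMeasure_of_le μ hτ
  have hs' : (s : ℝ≥0∞) < 1 := by exact_mod_cast hs
  have hsτ : (s : ℝ≥0∞) • τ ≤ μ :=
    le_trans (fun A => mul_le_of_le_one_left zero_le hs'.le) hτ
  have : IsFiniteMeasure ((s : ℝ≥0∞) • τ) := isFiniteMeasure_of_le μ hsτ
  have hsτ_univ : ((s : ℝ≥0∞) • τ) Set.univ < 1 :=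
    (mul_le_of_le_one_right zero_le ((hτ Set.univ).trans_eq measure_univ)).trans_lt hs'
  have := isProbabilityMeasure_inv_smul_sub hsτ hsτ_univ
  have h_toReal : (1 - ((s : ℝ≥0∞) • τ) Set.univ)⁻¹.toReal = (1 - s * τ.real Set.univ)⁻¹ := by
    rw [ENNReal.toReal_inv, ENNReal.toReal_sub_of_le hsτ_univ.le ENNReal.one_ne_top,
      ENNReal.toReal_one, Measure.smul_apply, smul_eq_mul, ENNReal.toReal_mul,
      ENNReal.coe_toReal, measureReal_def]
  have key := h.realEnergy_le_of_smul hm (Measure.sub_le (ν := (s : ℝ≥0∞) • τ))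
    (ENNReal.inv_ne_top.2 (tsub_pos_of_lt hsτ_univ).ne')
  rwa [h_toReal, toReal_mutualInteraction_self_of_add_smul_eq hk hk_even
    (Measure.sub_add_cancel_of_le hsτ) hτ h.interaction_ne_top] at key

theorem mul_mutualInteraction_le_of_le (h : IsRegularMinimizer k σ m μ) (hm : 1 < m)
    (hk : Measurable k) (hk_even : k.Even) (hτ : τ ≤ μ) :
    σ * (mutualInteraction k τ μ).toReal ≤ τ.real Set.univ *
      (σ * (mutualInteraction k μ μ).toReal +
        m * (densityPower m μ volume).toReal / (m - 1)) := by
  have h_le {s : NNReal} (hs : s < 1) := h.realEnergy_le_of_le hm hk hk_even hτ hs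
  rw [realEnergy] at h_le
  set V := (mutualInteraction k μ μ).toReal
  set W := (mutualInteraction k τ μ).toReal
  set T := (mutualInteraction k τ τ).toReal
  set F := (densityPower m μ volume).toReal
  set a := τ.real Set.univ
  have h_deriv : HasDerivAt (fun s : ℝ => σ / 2 * ((1 - s * a)⁻¹ ^ 2 *
      (V - 2 * s * W + s ^ 2 * T)) + (1 - s * a)⁻¹ ^ m * F / (m - 1))
      (σ / 2 * (2 * a * V - 2 * W) + m * a * F / (m - 1)) 0 := by
    have h_inv : HasDerivAt (fun s : ℝ => (1 - s * a)⁻¹) a 0 :=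
      (((hasDerivAt_id (0 : ℝ)).mul_const a).const_sub 1).inv (by simp) |>.congr_deriv (by simp)
    have h_quad : HasDerivAt (fun s : ℝ => V - 2 * s * W + s ^ 2 * T) (-(2 * W)) 0 :=
      ((((hasDerivAt_id (0 : ℝ)).const_mul 2).mul_const W).const_sub V).add
        ((hasDerivAt_pow 2 (0 : ℝ)).mul_const T) |>.congr_deriv (by simp)
    refine (((h_inv.pow 2).mul h_quad).const_mul (σ / 2)).add
      (((h_inv.rpow_const (p := m) (Or.inl (by simp))).mul_const F).div_const (m - 1))
        |>.congr_deriv ?_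
    simp only [Nat.cast_ofNat, zero_mul, sub_zero, inv_one, Nat.add_one_sub_one, one_pow, mul_one,
      mul_zero, ne_eq, OfNat.ofNat_ne_zero, not_false_eq_true, zero_pow, add_zero, Pi.pow_apply,
      mul_neg, one_mul, Real.one_rpow]
    ring
  have h_nonneg := nonneg_of_hasDerivAt_of_le h_deriv fun s hs => by
    lift s to NNReal using hs.1.le
    simpa using h_le (s := s) hs.2
  calc σ * W ≤ σ * W + (σ / 2 * (2 * a * V - 2 * W) + m * a * F / (m - 1)) :=
        le_add_of_nonneg_right h_nonneg
    _ = a * (σ * V + m * F / (m - 1)) := by ring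

theorem ae_lintegral_sub_le (h : IsRegularMinimizer k 1 m μ) (hm : 1 < m) (hk : Measurable k)
    (hk_even : k.Even) :
    ∀ᵐ x ∂μ, ∫⁻ y, k (x - y) ∂μ ≤ ENNReal.ofReal ((mutualInteraction k μ μ).toReal +
      m * (densityPower m μ volume).toReal / (m - 1)) := by
  refine ae_le_of_forall_setLIntegral_le_of_sigmaFinite (measurable_lintegral_sub hk)
    fun A _ _ => ?_
  have hA := h.mul_mutualInteraction_le_of_le hm hk hk_even (Measure.restrict_le_self (s := A))
  rw [one_mul, one_mul, measureReal_restrict_apply_univ, mul_comm] at hA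
  rw [lintegral_const, Measure.restrict_apply_univ, ← ofReal_measureReal,
    ← ENNReal.ofReal_mul' measureReal_nonneg]
  exact (ENNReal.le_ofReal_iff_toReal_le (ne_top_of_le_ne_top h.interaction_ne_top
    (mutualInteraction_mono Measure.restrict_le_self le_rfl)) (ENNReal.toReal_nonneg.trans hA)).2 hA

theorem ae_le_lintegral_sub (h : IsRegularMinimizer k (-1) m μ) (hm : 1 < m) (hk : Measurable k)
    (hk_even : k.Even) :
    ∀ᵐ x ∂μ, ENNReal.ofReal ((mutualInteraction k μ μ).toReal -
      m * (densityPower m μ volume).toReal / (m - 1)) ≤ ∫⁻ y, k (x - y) ∂μ := by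
  refine ae_le_of_forall_setLIntegral_le_of_sigmaFinite measurable_const fun A _ _ => ?_
  have hA := h.mul_mutualInteraction_le_of_le hm hk hk_even (Measure.restrict_le_self (s := A))
  rw [measureReal_restrict_apply_univ] at hA
  rw [lintegral_const, Measure.restrict_apply_univ, ← ofReal_measureReal,
    ← ENNReal.ofReal_mul' measureReal_nonneg]
  refine (ENNReal.ofReal_le_iff_le_toReal (ne_top_of_le_ne_top h.interaction_ne_top
    (mutualInteraction_mono Measure.restrict_le_self le_rfl))).2 ?_
  linarith

theorem realEnergy_le_map_smul (h : IsRegularMinimizer k σ m μ) (hm : 1 < m) {t : ℝ} (ht : 0 < t)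
    (hV : mutualInteraction k (μ.map (t • ·)) (μ.map (t • ·)) ≠ ∞) :
    realEnergy k σ m μ ≤ realEnergy k σ m (μ.map (t • ·)) := by
  have h_meas : Measurable fun x : E => t • x := measurable_const_smul t
  have := Measure.isProbabilityMeasure_map (μ := μ) h_meas.aemeasurable
  refine h.realEnergy_le _ (fun hmem => ?_) ?_ ?_ hV
  · rw [memLp_map_measure_iff aestronglyMeasurable_id h_meas.aemeasurable]
    exact hmem.const_smul t
  · refine (h.absolutelyContinuous.map h_meas).trans ?_
    rw [Measure.map_addHaar_smul volume ht.ne']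
    exact Measure.smul_absolutelyContinuous
  · rw [densityPower_map_smul (by linarith) ht]
    exact ENNReal.mul_ne_top ENNReal.ofReal_ne_top h.densityPower_ne_top

/-- The dilation `t ↦ μ.map (t • ·)` makes the energy stationary at `t = 1`. -/
theorem virial_identity {k₁ k₂ : E → ℝ≥0∞} {s₁ s₂ : ℝ} (h : IsRegularMinimizer (k₁ + k₂) σ m μ)
    (hm : 1 < m) (hk₁ : Measurable k₁) (hk₂ : Measurable k₂) (hs₁ : IsHomogeneousKernel s₁ k₁)
    (hs₂ : IsHomogeneousKernel s₂ k₂) :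
    σ / 2 * (s₁ * (mutualInteraction k₁ μ μ).toReal + s₂ * (mutualInteraction k₂ μ μ).toReal) =
      Module.finrank ℝ E * (densityPower m μ volume).toReal := by
  have h_ne_top := h.interaction_ne_top
  rw [mutualInteraction_add_kernel hk₁, ENNReal.add_ne_top] at h_ne_top
  obtain ⟨hV₁, hV₂⟩ := h_ne_top
  set V₁ := (mutualInteraction k₁ μ μ).toReal
  set V₂ := (mutualInteraction k₂ μ μ).toReal
  set F := (densityPower m μ volume).toReal
  set n := (Module.finrank ℝ E : ℝ) with hn
  let e : ℝ → ℝ := fun t =>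
    σ / 2 * (t ^ s₁ * V₁ + t ^ s₂ * V₂) + t ^ (-(n * (m - 1))) * F / (m - 1)
  have h_interaction {t : ℝ} (ht : 0 < t) :
      mutualInteraction (k₁ + k₂) (μ.map (t • ·)) (μ.map (t • ·)) =
        ENNReal.ofReal (t ^ s₁) * mutualInteraction k₁ μ μ +
          ENNReal.ofReal (t ^ s₂) * mutualInteraction k₂ μ μ := by
    rw [mutualInteraction_add_kernel hk₁, mutualInteraction_map_smul hk₁ hs₁ ht,
      mutualInteraction_map_smul hk₂ hs₂ ht]
  have h_energy {t : ℝ} (ht : 0 < t) : realEnergy (k₁ + k₂) σ m (μ.map (t • ·)) = e t := by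
    have h_nonneg (s : ℝ) : 0 ≤ t ^ s := Real.rpow_nonneg ht.le s
    rw [realEnergy, h_interaction ht, densityPower_map_smul (by linarith) ht,
      ENNReal.toReal_add (by finiteness) (by finiteness)]
    simp only [ENNReal.toReal_mul, ENNReal.toReal_ofReal (h_nonneg _), e, hn, V₁, V₂, F]
  have h_min : IsLocalMin e 1 := by
    filter_upwards [lt_mem_nhds one_pos] with t ht
    have h_one : realEnergy (k₁ + k₂) σ m μ = e 1 := by simpa using h_energy one_pos
    rw [← h_energy ht, ← h_one]
    exact h.realEnergy_le_map_smul hm ht (by rw [h_interaction ht]; finiteness)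
  have h_rpow (s : ℝ) : HasDerivAt (fun t : ℝ => t ^ s) s 1 :=
    (Real.hasDerivAt_rpow_const (Or.inl one_ne_zero)).congr_deriv (by simp)
  have h_deriv : HasDerivAt e (σ / 2 * (s₁ * V₁ + s₂ * V₂) - n * F) 1 := by
    refine ((((h_rpow s₁).mul_const V₁).add ((h_rpow s₂).mul_const V₂)).const_mul (σ / 2)).add
      (((h_rpow (-(n * (m - 1)))).mul_const F).div_const (m - 1)) |>.congr_deriv ?_
    have : m - 1 ≠ 0 := by linarith
    field_simp
    ring
  exact sub_eq_zero.1 (h_min.hasDerivAt_eq_zero h_deriv)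

end IsRegularMinimizer

end Minimizer

theorem mutualInteraction_ne_zero {G : Type*} [MeasurableSpace G] [AddGroup G] [MeasurableSub₂ G]
    {k : G → ℝ≥0∞} {μ : Measure G} [SFinite μ] [NullSingletonClass μ] [NeZero μ]
    (hk : Measurable k) (hk_pos : ∀ x ≠ 0, k x ≠ 0) : mutualInteraction k μ μ ≠ 0 := by
  intro h
  rw [mutualInteraction, lintegral_eq_zero_iff (measurable_lintegral_sub hk)] at h
  obtain ⟨x, hx⟩ := h.exists
  replace hx := (lintegral_eq_zero_iff (hk.comp (measurable_id.const_sub x))).1 hx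
  obtain ⟨y, hy, hxy⟩ := (hx.and (Measure.ae_ne μ x)).exists
  exact hk_pos (x - y) (sub_ne_zero.2 hxy.symm) hy

section RieszKernel

variable {E : Type*} [NormedAddCommGroup E] {p s m r ε : ℝ} {x y : E}

/-- The Riesz kernel `|x| ^ s` with values in `[0, ∞]`. The real power makes it vanish at the
origin, instead of being infinite, when `s < 0`; the measures below do not charge points. -/
noncomputable def rieszKernel (s : ℝ) (x : E) : ℝ≥0∞ :=
  ENNReal.ofReal (‖x‖ ^ s)

theorem even_rieszKernel (s : ℝ) : (rieszKernel s : E → ℝ≥0∞).Even := fun x => by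
  rw [rieszKernel, rieszKernel, norm_neg]

theorem rieszKernel_ne_zero (hx : x ≠ 0) : rieszKernel s x ≠ 0 := by
  have := norm_pos_iff.2 hx
  rw [rieszKernel, ne_eq, ENNReal.ofReal_eq_zero, not_le]
  positivity

theorem rieszKernel_le_of_le_norm (hp : p ≤ 0) (hr : 0 < r) (hx : r ≤ ‖x‖) :
    rieszKernel p x ≤ ENNReal.ofReal (r ^ p) :=
  ENNReal.ofReal_le_ofReal (Real.rpow_le_rpow_of_nonpos hr hx hp)

theorem rieszKernel_lt_of_norm_lt (hp : p < 0) (hx : x ≠ 0) (hxy : ‖x‖ < ‖y‖) :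
    rieszKernel p y < rieszKernel p x := by
  have hx' := norm_pos_iff.2 hx
  exact (ENNReal.ofReal_lt_ofReal_iff (by positivity)).2 (Real.rpow_lt_rpow_of_neg hx' hxy hp)

theorem isHomogeneousKernel_rieszKernel [NormedSpace ℝ E] (s : ℝ) :
    IsHomogeneousKernel s (rieszKernel s : E → ℝ≥0∞) := fun t ht x => by
  rw [rieszKernel, rieszKernel, ← ENNReal.ofReal_mul (by positivity), norm_smul,
    Real.mul_rpow (norm_nonneg t) (norm_nonneg x), Real.norm_of_nonneg ht.le]

theorem rieszKernel_rpow_le (hp : p < 0) {q : ℝ} (hq : 0 < q) (hs : s ≤ p * q) (hx : ‖x‖ ≤ 1) :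
    rieszKernel p x ^ q ≤ rieszKernel s x := by
  rw [rieszKernel, rieszKernel, ENNReal.ofReal_rpow_of_nonneg (by positivity) hq.le,
    ← Real.rpow_mul (norm_nonneg _)]
  refine ENNReal.ofReal_le_ofReal ?_
  rcases eq_or_ne x 0 with rfl | hx0
  · rw [norm_zero, Real.zero_rpow (mul_neg_of_neg_of_pos hp hq).ne]
    positivity
  · exact Real.rpow_le_rpow_of_exponent_ge (norm_pos_iff.2 hx0) hx hs

variable [MeasurableSpace E] [BorelSpace E]

theorem measurable_rieszKernel (s : ℝ) : Measurable (rieszKernel s : E → ℝ≥0∞) :=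
  (measurable_norm.pow_const s).ennreal_ofReal

theorem lintegral_rieszKernel_sub_le {μ : Measure E}
    [IsProbabilityMeasure μ] (hp : p ≤ 0) (hε : 0 < ε) (hr : 0 < r) (x : E) :
    ∫⁻ y, rieszKernel p (x - y) ∂μ ≤ ∫⁻ y in ball x ε, rieszKernel p (x - y) ∂μ +
      ENNReal.ofReal (ε ^ p) * μ (ball x r) + ENNReal.ofReal (r ^ p) := by
  have h_le {a : ℝ} (ha : 0 < a) {y : E} (hy : y ∉ ball x a) :
      rieszKernel p (x - y) ≤ ENNReal.ofReal (a ^ p) :=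
    rieszKernel_le_of_le_norm hp ha (by simpa [dist_eq_norm, norm_sub_rev] using hy)
  have h_regions (y : E) : rieszKernel p (x - y) ≤
      (ball x ε).indicator (fun y => rieszKernel p (x - y)) y +
        (ball x r).indicator (fun _ => ENNReal.ofReal (ε ^ p)) y + ENNReal.ofReal (r ^ p) := by
    by_cases h_near : y ∈ ball x ε
    · rw [Set.indicator_of_mem h_near, add_assoc]
      exact le_self_add
    by_cases h_middle : y ∈ ball x r
    · rw [Set.indicator_of_notMem h_near, Set.indicator_of_mem h_middle, zero_add]
      exact (h_le hε h_near).trans le_self_add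
    · exact (h_le hr h_middle).trans le_add_self
  calc ∫⁻ y, rieszKernel p (x - y) ∂μ ≤ _ := lintegral_mono h_regions
    _ = _ := by
      rw [lintegral_add_right _ measurable_const, lintegral_add_right _
        (measurable_const.indicator measurableSet_ball), lintegral_indicator measurableSet_ball,
        lintegral_indicator measurableSet_ball, setLIntegral_const, lintegral_const, measure_univ,
        mul_one]

variable [NormedSpace ℝ E] [FiniteDimensional ℝ E] (ν : Measure E) [ν.IsAddHaarMeasure]

theorem setLIntegral_ball_rieszKernel_ne_top (hs : -(Module.finrank ℝ E : ℝ) < s)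
    (hE : 0 < Module.finrank ℝ E) (r : ℝ) : ∫⁻ x in ball (0 : E) r, rieszKernel s x ∂ν ≠ ∞ := by
  have h_int : IntegrableOn (fun x : E => ‖x‖ ^ s) (ball 0 r) ν :=
    integrableOn_ball_of_norm_le_rpow (α := -s) (C := 1) hE (by linarith)
      (ae_of_all _ fun x => by
        rw [neg_neg, one_mul, Real.norm_of_nonneg (Real.rpow_nonneg (norm_nonneg x) s)])
      (measurable_norm.pow_const s).aestronglyMeasurable
  exact h_int.lintegral_lt_top.ne

theorem tendsto_setLIntegral_ball_rieszKernel (hs : -(Module.finrank ℝ E : ℝ) < s)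
    (hE : 0 < Module.finrank ℝ E) :
    Tendsto (fun ε => ∫⁻ x in ball (0 : E) ε, rieszKernel s x ∂ν) (𝓝[>] 0) (𝓝 0) := by
  have : Nontrivial E := Module.finrank_pos_iff.1 hE
  have h_ball : Tendsto (fun ε => (ν.restrict (ball 0 1)) (ball (0 : E) ε)) (𝓝[>] 0) (𝓝 0) := by
    have := tendsto_measure_thickening_of_isClosed (μ := ν.restrict (ball 0 1))
      ⟨1, one_pos, by rw [thickening_singleton]; finiteness⟩ (isClosed_singleton (x := (0 : E)))
    simpa only [thickening_singleton, measure_singleton] using this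
  refine (tendsto_setLIntegral_zero (setLIntegral_ball_rieszKernel_ne_top ν hs hE 1)
    h_ball).congr' ?_
  filter_upwards [Ioc_mem_nhdsGT one_pos] with ε hε
  rw [Measure.restrict_restrict measurableSet_ball, Set.inter_eq_left.2 (ball_subset_ball hε.2)]

theorem setLIntegral_ball_sub_left {f : E → ℝ≥0∞} (x : E) (r : ℝ) :
    ∫⁻ y in ball x r, f (x - y) ∂ν = ∫⁻ y in ball 0 r, f y ∂ν := by
  rw [← lintegral_indicator measurableSet_ball, ← lintegral_indicator measurableSet_ball,
    ← lintegral_sub_left_eq_self _ x]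
  refine lintegral_congr fun y => ?_
  simp only [Set.indicator, mem_ball, dist_eq_norm, sub_sub_cancel, sub_zero,
    sub_sub_cancel_left, norm_neg]

theorem setLIntegral_ball_rieszKernel_sub_le {μ : Measure E} [SigmaFinite μ] (hp : p < 0)
    (hm : 1 < m) (hs : s ≤ p * (m / (m - 1))) (hε : ε ≤ 1) (hμ : μ ≪ ν) (x : E) :
    ∫⁻ y in ball x ε, rieszKernel p (x - y) ∂μ ≤
      ∫⁻ y in ball (0 : E) ε, rieszKernel s y ∂ν + densityPower m μ ν / ENNReal.ofReal m := by
  set q := m / (m - 1)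
  have h_conj : q.HolderConjugate m := (Real.HolderConjugate.conjExponent hm).symm
  have hρ := Measure.measurable_rnDeriv μ ν
  have hk (s : ℝ) : Measurable fun y : E => rieszKernel s (x - y) :=
    (measurable_rieszKernel s).comp (measurable_id.const_sub x)
  have h_young {y : E} (hy : y ∈ ball x ε) : μ.rnDeriv ν y * rieszKernel p (x - y) ≤
      rieszKernel s (x - y) + μ.rnDeriv ν y ^ m / ENNReal.ofReal m := by
    have hxy : ‖x - y‖ ≤ 1 := by
      rw [← dist_eq_norm, dist_comm]
      exact (mem_ball.1 hy).le.trans hε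
    calc μ.rnDeriv ν y * rieszKernel p (x - y)
        ≤ rieszKernel p (x - y) ^ q / ENNReal.ofReal q + μ.rnDeriv ν y ^ m / ENNReal.ofReal m := by
          rw [mul_comm]
          exact ENNReal.young_inequality _ _ h_conj
      _ ≤ _ := by
          gcongr
          exact (ENNReal.div_le_of_le_mul (le_mul_of_one_le_right zero_le
            (ENNReal.one_le_ofReal.2 h_conj.lt.le))).trans
              (rieszKernel_rpow_le hp h_conj.pos hs hxy)
  calc ∫⁻ y in ball x ε, rieszKernel p (x - y) ∂μ
      = ∫⁻ y in ball x ε, μ.rnDeriv ν y * rieszKernel p (x - y) ∂ν := by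
        conv_lhs => rw [← Measure.withDensity_rnDeriv_eq μ ν hμ]
        exact setLIntegral_withDensity_eq_setLIntegral_mul _ hρ (hk p) measurableSet_ball
    _ ≤ ∫⁻ y in ball x ε, (rieszKernel s (x - y) + μ.rnDeriv ν y ^ m / ENNReal.ofReal m) ∂ν :=
        setLIntegral_mono ((hk s).add ((hρ.pow_const m).div_const _)) fun _ => h_young
    _ = ∫⁻ y in ball (0 : E) ε, rieszKernel s y ∂ν +
          (∫⁻ y in ball x ε, μ.rnDeriv ν y ^ m ∂ν) / ENNReal.ofReal m := by
        simp only [div_eq_mul_inv]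
        rw [lintegral_add_left (hk s), setLIntegral_ball_sub_left,
          lintegral_mul_const _ (hρ.pow_const m)]
    _ ≤ _ := by
        gcongr
        exact setLIntegral_le_lintegral _ _

theorem mutualInteraction_rieszKernel_le {μ : Measure E} [IsProbabilityMeasure μ] (hp : p < 0)
    (hm : 1 < m) (hs : s ≤ p * (m / (m - 1))) (hμ : μ ≪ ν) :
    mutualInteraction (rieszKernel p) μ μ ≤
      ∫⁻ y in ball (0 : E) 1, rieszKernel s y ∂ν + densityPower m μ ν / ENNReal.ofReal m +
        1 + 1 := by
  refine lintegral_le_const (ae_of_all _ fun x => ?_)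
  calc ∫⁻ y, rieszKernel p (x - y) ∂μ ≤ ∫⁻ y in ball x 1, rieszKernel p (x - y) ∂μ +
        ENNReal.ofReal (1 ^ p) * μ (ball x 1) + ENNReal.ofReal (1 ^ p) :=
        lintegral_rieszKernel_sub_le hp.le one_pos one_pos x
    _ ≤ _ := by
        rw [Real.one_rpow, ENNReal.ofReal_one, one_mul]
        gcongr
        exacts [setLIntegral_ball_rieszKernel_sub_le ν hp hm hs le_rfl hμ x, prob_le_one]

theorem mutualInteraction_rieszKernel_ne_top {μ : Measure E} [IsProbabilityMeasure μ] (hp : p < 0)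
    (hm : 1 < m) (hs : s ≤ p * (m / (m - 1))) (hs_lt : -(Module.finrank ℝ E : ℝ) < s)
    (hE : 0 < Module.finrank ℝ E) (hμ : μ ≪ ν) (hF : densityPower m μ ν ≠ ∞) :
    mutualInteraction (rieszKernel p) μ μ ≠ ∞ := by
  have h_ball := setLIntegral_ball_rieszKernel_ne_top ν hs_lt hE 1
  have hm_pos : ENNReal.ofReal m ≠ 0 := (ENNReal.ofReal_pos.2 (by linarith)).ne'
  exact ne_top_of_le_ne_top (by finiteness) (mutualInteraction_rieszKernel_le ν hp hm hs hμ)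

end RieszKernel

theorem eventually_le_mul_div_sub_one {s p : ℝ} (hsp : s < p) :
    ∀ᶠ m : ℝ in atTop, s ≤ p * (m / (m - 1)) := by
  filter_upwards [eventually_gt_atTop 1, eventually_ge_atTop (-s / (p - s))] with m hm hms
  rw [div_le_iff₀ (sub_pos.2 hsp)] at hms
  rw [mul_div, le_div_iff₀ (sub_pos.2 hm)]
  linarith

section EnergyMinimizer

variable {d : ℕ} {K : EuclideanSpace ℝ (Fin d) → ℝ} {σ m : ℝ}

theorem mem_finiteSecondMoment_iff {μ : ProbabilityMeasure (EuclideanSpace ℝ (Fin d))} :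
    μ ∈ finiteSecondMoment d ↔ MemLp id 2 (μ : Measure (EuclideanSpace ℝ (Fin d))) := by
  rw [MemLp, and_iff_right aestronglyMeasurable_id,
    eLpNorm_lt_top_iff_lintegral_rpow_enorm_lt_top two_ne_zero ENNReal.ofNat_ne_top]
  simp [finiteSecondMoment]

theorem energy_le_of_isEnergyMinimizer_or {μ : ProbabilityMeasure (EuclideanSpace ℝ (Fin d))}
    (h : IsEnergyMinimizer K m (finiteSecondMoment d) μ ∨ IsEnergyMinimizer K m Set.univ μ)
    {ν : Measure (EuclideanSpace ℝ (Fin d))} [IsProbabilityMeasure ν]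
    (hmem : MemLp id 2 (μ : Measure (EuclideanSpace ℝ (Fin d))) → MemLp id 2 ν) :
    energy K m μ ≤ energy K m ν := by
  rcases h with ⟨hμ, h⟩ | ⟨-, h⟩
  · exact h ⟨ν, ‹_›⟩ (mem_finiteSecondMoment_iff.2 (hmem (mem_finiteSecondMoment_iff.1 hμ)))
  · exact h ⟨ν, ‹_›⟩ (Set.mem_univ _)

variable {μ : Measure (EuclideanSpace ℝ (Fin d))}

theorem energy_eq_coe_realEnergy [SigmaFinite μ] (hσ : σ = 1 ∨ σ = -1) (hK : ∀ x, 0 ≤ σ * K x)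
    (hm : 1 < m) (hμ : μ ≪ volume) (hF : densityPower m μ volume ≠ ∞)
    (hV : mutualInteraction (fun x => ENNReal.ofReal (σ * K x)) μ μ ≠ ∞) :
    energy K m μ = (realEnergy (fun x => ENNReal.ofReal (σ * K x)) σ m μ : EReal) := by
  have h_coe {a : ℝ≥0∞} (ha : a ≠ ∞) : (a : EReal) = (a.toReal : EReal) := by
    lift a to NNReal using ha
    rfl
  have h_renyi :
      (renyiEntropy m μ : EReal) = ((densityPower m μ volume).toReal / (m - 1) : ℝ) := by
    rw [renyiEntropy, ← densityPower, h_coe (ENNReal.mul_ne_top ENNReal.ofReal_ne_top hF),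
      ENNReal.toReal_mul, ENNReal.toReal_ofReal (one_div_nonneg.2 (sub_pos.2 hm).le),
      one_div_mul_eq_div]
  have h_interaction : interactionEnergy K μ =
      (σ / 2 * (mutualInteraction (fun x => ENNReal.ofReal (σ * K x)) μ μ).toReal : ℝ) := by
    rcases hσ with rfl | rfl
    · have h_neg (x) : ENNReal.ofReal (-K x) = 0 :=
        ENNReal.ofReal_of_nonpos (by linarith [hK x])
      simp only [one_mul, mutualInteraction] at hV ⊢
      simp only [interactionEnergy, h_neg, lintegral_zero, mul_zero]
      rw [h_coe (by finiteness)]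
      simp
    · have h_pos (x) : ENNReal.ofReal (K x) = 0 :=
        ENNReal.ofReal_of_nonpos (by linarith [hK x])
      simp only [neg_mul, one_mul, mutualInteraction] at hV ⊢
      simp only [interactionEnergy, h_pos, lintegral_zero, mul_zero]
      rw [EReal.coe_ennreal_zero, zero_sub, h_coe (by finiteness), ENNReal.toReal_mul]
      simp [neg_div]
  rw [energy, if_pos ⟨hμ, (memLp_toReal_rnDeriv_iff (zero_lt_one.trans hm)).2 hF⟩, h_renyi,
    h_interaction, realEnergy, EReal.coe_add]

theorem densityPower_ne_top_of_energy_ne_top [SigmaFinite μ] (hm : 1 < m)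
    (h : energy K m μ ≠ ⊤) : μ ≪ volume ∧ densityPower m μ volume ≠ ∞ := by
  rw [← memLp_toReal_rnDeriv_iff (zero_lt_one.trans hm)]
  by_contra h_neg
  exact h (if_neg h_neg)

theorem mutualInteraction_ne_top_of_energy_ne_top (hK : ∀ x, 0 ≤ K x) (h : energy K m μ ≠ ⊤) :
    mutualInteraction (fun x => ENNReal.ofReal (K x)) μ μ ≠ ∞ := by
  intro h_top
  have h_neg (x) : ENNReal.ofReal (-K x) = 0 := ENNReal.ofReal_of_nonpos (neg_nonpos.2 (hK x))
  rw [mutualInteraction] at h_top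
  rw [energy] at h
  split_ifs at h
  · simp [interactionEnergy, h_neg, h_top] at h
  · exact h rfl

theorem isRegularMinimizer_of_isEnergyMinimizer_or
    {μ : ProbabilityMeasure (EuclideanSpace ℝ (Fin d))} (hσ : σ = 1 ∨ σ = -1)
    (hK : ∀ x, 0 ≤ σ * K x) (hm : 1 < m)
    (h : IsEnergyMinimizer K m (finiteSecondMoment d) μ ∨ IsEnergyMinimizer K m Set.univ μ)
    (hμ : energy K m μ ≠ ⊤)
    (hV : mutualInteraction (fun x => ENNReal.ofReal (σ * K x))
      (μ : Measure (EuclideanSpace ℝ (Fin d))) μ ≠ ∞) :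
    IsRegularMinimizer (fun x => ENNReal.ofReal (σ * K x)) σ m
      (μ : Measure (EuclideanSpace ℝ (Fin d))) := by
  obtain ⟨hμ_ac, hμ_F⟩ := densityPower_ne_top_of_energy_ne_top hm hμ
  refine ⟨hμ_ac, hμ_F, hV, fun ν _ hmem hν hνF hνV => ?_⟩
  rw [← EReal.coe_le_coe_iff, ← energy_eq_coe_realEnergy hσ hK hm hμ_ac hμ_F hV,
    ← energy_eq_coe_realEnergy hσ hK hm hν hνF hνV]
  exact energy_le_of_isEnergyMinimizer_or h hmem

theorem energy_ne_top_of_isEnergyMinimizer_or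
    (hσ : σ = 1 ∨ σ = -1) (hK : ∀ x, 0 ≤ σ * K x) (hm : 1 < m)
    {μ : ProbabilityMeasure (EuclideanSpace ℝ (Fin d))}
    (h : IsEnergyMinimizer K m (finiteSecondMoment d) μ ∨ IsEnergyMinimizer K m Set.univ μ)
    {η : Measure (EuclideanSpace ℝ (Fin d))} [IsProbabilityMeasure η] (hη : η ≤ volume)
    (hη_mem : MemLp id 2 η)
    (hη_V : mutualInteraction (fun x => ENNReal.ofReal (σ * K x)) η η ≠ ∞) :
    energy K m μ ≠ ⊤ := by
  refine ne_top_of_le_ne_top ?_ (energy_le_of_isEnergyMinimizer_or h fun _ => hη_mem)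
  rw [energy_eq_coe_realEnergy hσ hK hm hη.absolutelyContinuous (ne_top_of_le_ne_top
    ENNReal.one_ne_top ((densityPower_le_measure_univ hη hm.le).trans_eq measure_univ)) hη_V]
  exact EReal.coe_ne_top _

end EnergyMinimizer

section Competitor

variable {E : Type*} [NormedAddCommGroup E] [NormedSpace ℝ E] [FiniteDimensional ℝ E]
  [MeasurableSpace E] [BorelSpace E]

theorem exists_isProbabilityMeasure_le_addHaar (ν : Measure E) [ν.IsAddHaarMeasure]
    (hE : 0 < Module.finrank ℝ E) :
    ∃ η : Measure E, IsProbabilityMeasure η ∧ η ≤ ν ∧ ∃ r, ∀ᵐ x ∂η, ‖x‖ ≤ r := by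
  have : Nontrivial E := Module.finrank_pos_iff.1 hE
  have : NoncompactSpace E := NormedSpace.noncompactSpace ℝ E
  obtain ⟨A, -, hA, hνA⟩ := isOpen_univ.exists_lt_isCompact (μ := ν) (r := 1)
    (by simp [measure_univ_of_isAddLeftInvariant])
  obtain ⟨r, hr⟩ := hA.isBounded.exists_norm_le
  refine ⟨ProbabilityTheory.cond ν A, ProbabilityTheory.cond_isProbabilityMeasure_of_finite
    (one_pos.trans hνA).ne' hA.measure_ne_top, ?_, r, ?_⟩
  · calc (ν A)⁻¹ • ν.restrict A ≤ (1 : ℝ≥0∞) • ν := by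
          gcongr
          exacts [ENNReal.inv_le_one.2 hνA.le, Measure.restrict_le_self]
      _ = ν := one_smul _ ν
  · exact Measure.ae_smul_measure (ae_restrict_of_forall_mem hA.measurableSet hr) _

end Competitor

section BoundedPotential

variable {E : Type*} [NormedAddCommGroup E] [MeasurableSpace E] [BorelSpace E]

theorem exists_ae_norm_sub_le_of_ae_lintegral_rieszKernel_le {q : ℝ} (hq : 0 < q) {C : ℝ≥0∞}
    (hC : C ≠ ∞) {μ : Measure E} [IsProbabilityMeasure μ]
    (h : ∀ᵐ x ∂μ, ∫⁻ y, rieszKernel q (x - y) ∂μ ≤ C) :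
    ∃ a, ∀ᵐ x ∂μ, ‖x - a‖ ≤ 2 * (2 * C).toReal ^ q⁻¹ := by
  obtain ⟨a, ha⟩ := h.exists
  refine ⟨a, h.mono fun x hx => ?_⟩
  have hk (z : E) : Measurable fun y => rieszKernel q (z - y) :=
    (measurable_rieszKernel q).comp (measurable_id.const_sub z)
  obtain ⟨y, hy⟩ := exists_le_lintegral (μ := μ) ((hk x).add (hk a)).aemeasurable
  have h_sum : rieszKernel q (x - y) + rieszKernel q (a - y) ≤ 2 * C :=
    calc _ ≤ ∫⁻ y, (rieszKernel q (x - y) + rieszKernel q (a - y)) ∂μ := hy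
      _ = ∫⁻ y, rieszKernel q (x - y) ∂μ + ∫⁻ y, rieszKernel q (a - y) ∂μ :=
        lintegral_add_left (hk x) _
      _ ≤ C + C := add_le_add hx ha
      _ = 2 * C := (two_mul C).symm
  have h_norm_le {z : E} (hz : rieszKernel q z ≤ 2 * C) : ‖z‖ ≤ (2 * C).toReal ^ q⁻¹ := by
    rw [rieszKernel, ENNReal.ofReal_le_iff_le_toReal (by finiteness)] at hz
    rwa [← Real.rpow_le_rpow_iff (norm_nonneg z) (by positivity) hq,
      Real.rpow_inv_rpow ENNReal.toReal_nonneg hq.ne']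
  calc ‖x - a‖ = ‖(x - y) - (a - y)‖ := by rw [sub_sub_sub_cancel_right]
    _ ≤ ‖x - y‖ + ‖a - y‖ := norm_sub_le _ _
    _ ≤ (2 * C).toReal ^ q⁻¹ + (2 * C).toReal ^ q⁻¹ :=
        add_le_add (h_norm_le (le_self_add.trans h_sum)) (h_norm_le (le_add_self.trans h_sum))
    _ = 2 * (2 * C).toReal ^ q⁻¹ := (two_mul _).symm

end BoundedPotential

namespace IsRegularMinimizer

variable {E : Type*} [NormedAddCommGroup E] [InnerProductSpace ℝ E] [FiniteDimensional ℝ E]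
  [MeasurableSpace E] [BorelSpace E] {k k₁ k₂ : E → ℝ≥0∞} {σ m : ℝ} {μ η : Measure E}

theorem realEnergy_le_of_le_volume (h : IsRegularMinimizer k σ m μ) (hm : 1 < m)
    [IsProbabilityMeasure η] (hη : η ≤ volume) (hη_mem : MemLp id 2 η)
    (hη_V : mutualInteraction k η η ≠ ∞) :
    realEnergy k σ m μ ≤ σ / 2 * (mutualInteraction k η η).toReal + 1 / (m - 1) := by
  have hF : densityPower m η volume ≤ 1 :=
    (densityPower_le_measure_univ hη hm.le).trans_eq measure_univ
  refine (h.realEnergy_le η (fun _ => hη_mem) (Measure.absolutelyContinuous_of_le hη)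
    (ne_top_of_le_ne_top ENNReal.one_ne_top hF) hη_V).trans ?_
  rw [realEnergy]
  gcongr
  exact ENNReal.toReal_mono ENNReal.one_ne_top hF

variable [IsProbabilityMeasure μ]

theorem ae_lintegral_sub_le_of_homogeneous {q p : ℝ} (h : IsRegularMinimizer (k₁ + k₂) 1 m μ)
    (hm : 2 ≤ m) (hE : 0 < Module.finrank ℝ E) (hk₁ : Measurable k₁) (hk₂ : Measurable k₂)
    (hk₁_even : k₁.Even) (hk₂_even : k₂.Even) (hq : IsHomogeneousKernel q k₁)
    (hp : IsHomogeneousKernel p k₂) (hq_nonneg : 0 ≤ q) (hp_nonpos : p ≤ 0)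
    [IsProbabilityMeasure η] (hη : η ≤ volume) (hη_mem : MemLp id 2 η)
    (hη_V : mutualInteraction (k₁ + k₂) η η ≠ ∞) :
    ∀ᵐ x ∂μ, ∫⁻ y, (k₁ + k₂) (x - y) ∂μ ≤
      ENNReal.ofReal ((1 + q) * ((mutualInteraction (k₁ + k₂) η η).toReal + 2)) := by
  have hm_one : 1 < m := by linarith
  have h_virial := h.virial_identity hm_one hk₁ hk₂ hq hp
  have h_energy := h.realEnergy_le_of_le_volume hm_one hη hη_mem hη_V
  refine (h.ae_lintegral_sub_le hm_one (hk₁.add hk₂) (hk₁_even.add hk₂_even)).mono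
    fun x hx => hx.trans (ENNReal.ofReal_le_ofReal ?_)
  have h_V₁_le : (mutualInteraction k₁ μ μ).toReal ≤ (mutualInteraction (k₁ + k₂) μ μ).toReal :=
    ENNReal.toReal_mono h.interaction_ne_top
      (by rw [mutualInteraction_add_kernel hk₁]; exact le_self_add)
  rw [realEnergy] at h_energy
  have h_V₂_nonneg : 0 ≤ (mutualInteraction k₂ μ μ).toReal := ENNReal.toReal_nonneg
  have h_F_nonneg : 0 ≤ (densityPower m μ volume).toReal := ENNReal.toReal_nonneg
  set V := (mutualInteraction (k₁ + k₂) μ μ).toReal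
  set Vη := (mutualInteraction (k₁ + k₂) η η).toReal
  set F := (densityPower m μ volume).toReal
  have h_V : V ≤ Vη + 2 := by
    have h_entropy : 0 ≤ F / (m - 1) := div_nonneg h_F_nonneg (by linarith)
    have h_inv : 1 / (m - 1) ≤ 1 := by rw [div_le_one] <;> linarith
    linarith
  have h_F : F ≤ q / 2 * V := by
    have hE' : (1 : ℝ) ≤ Module.finrank ℝ E := by exact_mod_cast hE
    nlinarith [mul_nonneg_of_nonpos_of_nonpos hp_nonpos (neg_nonpos.2 h_V₂_nonneg)]
  calc V + m * F / (m - 1) ≤ V + 2 * F := by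
        gcongr
        rw [div_le_iff₀ (by linarith)]
        nlinarith
    _ ≤ (1 + q) * V := by linarith
    _ ≤ (1 + q) * (Vη + 2) := by gcongr

theorem two_mul_densityPower_le {p : ℝ} (h : IsRegularMinimizer k (-1) m μ) (hm : 1 < m)
    (hk : Measurable k) (hp : IsHomogeneousKernel p k) (hE : 0 < Module.finrank ℝ E)
    (hp_gt : -(Module.finrank ℝ E : ℝ) < p) :
    2 * (densityPower m μ volume).toReal ≤ (mutualInteraction k μ μ).toReal := by
  rw [← add_zero k] at h
  have h_virial := h.virial_identity hm hk measurable_zero hp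
    (s₂ := 0) fun t _ _ => (mul_zero (ENNReal.ofReal (t ^ (0 : ℝ)))).symm
  rw [zero_mul, add_zero] at h_virial
  have hE' : (0 : ℝ) < Module.finrank ℝ E := by exact_mod_cast hE
  have hV : 0 ≤ (mutualInteraction k μ μ).toReal := ENNReal.toReal_nonneg
  refine le_of_mul_le_mul_left ?_ hE'
  nlinarith

theorem ae_ofReal_le_lintegral_sub {p : ℝ} (h : IsRegularMinimizer k (-1) m μ) (hm : 3 ≤ m)
    (hk : Measurable k) (hk_even : k.Even) (hp : IsHomogeneousKernel p k)
    (hE : 0 < Module.finrank ℝ E) (hp_gt : -(Module.finrank ℝ E : ℝ) < p)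
    [IsProbabilityMeasure η] (hη : η ≤ volume) (hη_mem : MemLp id 2 η)
    (hη_V : mutualInteraction k η η ≠ ∞)
    (hmη : 4 ≤ (m - 1) * (mutualInteraction k η η).toReal) :
    ∀ᵐ x ∂μ, ENNReal.ofReal ((mutualInteraction k η η).toReal / 8) ≤ ∫⁻ y, k (x - y) ∂μ := by
  have hm_one : 1 < m := by linarith
  have h_energy := h.realEnergy_le_of_le_volume hm_one hη hη_mem hη_V
  have h_F := h.two_mul_densityPower_le hm_one hk hp hE hp_gt
  refine (h.ae_le_lintegral_sub hm_one hk hk_even).mono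
    fun x hx => (ENNReal.ofReal_le_ofReal ?_).trans hx
  rw [realEnergy] at h_energy
  have h_F_nonneg : 0 ≤ (densityPower m μ volume).toReal := ENNReal.toReal_nonneg
  set V := (mutualInteraction k μ μ).toReal
  set Vη := (mutualInteraction k η η).toReal
  set F := (densityPower m μ volume).toReal
  have h_V : Vη / 2 ≤ V := by
    have h_entropy : 0 ≤ F / (m - 1) := div_nonneg h_F_nonneg (by linarith)
    have h_inv : 1 / (m - 1) ≤ Vη / 4 := by
      rw [div_le_div_iff₀ (by linarith) four_pos]
      linarith
    linarith
  calc Vη / 8 ≤ V - 3 / 2 * F := by linarith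
    _ ≤ V - m * F / (m - 1) := by
        gcongr
        rw [div_le_iff₀ (by linarith)]
        nlinarith

theorem densityPower_le {p s : ℝ} {c : ℝ≥0∞} (h : IsRegularMinimizer (c • rieszKernel p) (-1) m μ)
    (hm : 1 < m) (hp_neg : p < 0) (hE : 0 < Module.finrank ℝ E)
    (hs : -(Module.finrank ℝ E : ℝ) < s) (hsp : s < p) (hsm : s ≤ p * (m / (m - 1)))
    (hc : c ≠ ∞) (hcm : c.toReal ≤ m) :
    (densityPower m μ volume).toReal ≤
      c.toReal * ((∫⁻ x in ball (0 : E) 1, rieszKernel s x).toReal + 2) := by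
  have h_F := h.two_mul_densityPower_le hm ((measurable_rieszKernel p).const_smul c)
    ((isHomogeneousKernel_rieszKernel p).const_smul c) hE (hs.trans hsp)
  have hm_pos : ENNReal.ofReal m ≠ 0 := (ENNReal.ofReal_pos.2 (by linarith)).ne'
  have h_ball := setLIntegral_ball_rieszKernel_ne_top volume hs hE 1
  have h_F_ne_top := h.densityPower_ne_top
  have h_V := ENNReal.toReal_mono (by finiteness)
    (mutualInteraction_rieszKernel_le volume hp_neg hm hsm h.absolutelyContinuous)
  rw [ENNReal.toReal_add (by finiteness) (by finiteness),
    ENNReal.toReal_add (by finiteness) (by finiteness),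
    ENNReal.toReal_add (by finiteness) (by finiteness), ENNReal.toReal_div, ENNReal.toReal_one,
    ENNReal.toReal_ofReal (by linarith)] at h_V
  rw [mutualInteraction_smul_kernel hc, ENNReal.toReal_mul] at h_F
  have h_absorb : c.toReal * ((densityPower m μ volume).toReal / m) ≤
      (densityPower m μ volume).toReal := by
    rw [← mul_div_assoc, div_le_iff₀ (by linarith), mul_comm]
    gcongr
  have := mul_le_mul_of_nonneg_left h_V (ENNReal.toReal_nonneg (a := c))
  linarith

end IsRegularMinimizer

theorem exists_eventually_le_measureReal_ball {E : Type*} [NormedAddCommGroup E] [NormedSpace ℝ E]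
    [FiniteDimensional ℝ E] [MeasurableSpace E] [BorelSpace E] (ν : Measure E)
    [ν.IsAddHaarMeasure] {p s w Φ : ℝ} (hp : p < 0) (hE : 0 < Module.finrank ℝ E)
    (hs : -(Module.finrank ℝ E : ℝ) < s) (hsp : s < p) (hw : 0 < w) :
    ∃ r > 0, ∃ δ > 0, ∀ᶠ m in atTop, ∀ μ : Measure E, IsProbabilityMeasure μ → μ ≪ ν →
      densityPower m μ ν ≤ ENNReal.ofReal Φ →
        ∀ x, ENNReal.ofReal w ≤ ∫⁻ y, rieszKernel p (x - y) ∂μ → δ ≤ μ.real (ball x r) := by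
  have hw_four : 0 < w / 4 := by linarith
  obtain ⟨ε, h_near, hε, hε_one⟩ :=
    (((tendsto_setLIntegral_ball_rieszKernel ν hs hE).eventually_le_const
      (ENNReal.ofReal_pos.2 hw_four)).and (Ioc_mem_nhdsGT one_pos)).exists
  obtain ⟨r, h_far, hr⟩ := (((tendsto_rpow_neg_atTop (neg_pos.2 hp)).eventually_le_const
    hw_four).and (eventually_gt_atTop 0)).exists
  rw [neg_neg] at h_far
  have hε_rpow : 0 < ε ^ p := Real.rpow_pos_of_pos hε p
  refine ⟨r, hr, w / 4 / ε ^ p, by positivity, ?_⟩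
  filter_upwards [eventually_gt_atTop 1, eventually_le_mul_div_sub_one hsp,
    (tendsto_id.const_div_atTop Φ).eventually_le_const hw_four]
    with m hm hsm h_entropy μ _ hμ hF x hx
  have h_entropy_le : ENNReal.ofReal Φ / ENNReal.ofReal m ≤ ENNReal.ofReal (w / 4) := by
    rw [← ENNReal.ofReal_div_of_pos (by linarith)]
    exact ENNReal.ofReal_le_ofReal h_entropy
  have h_bound :=
    calc ENNReal.ofReal w
        ≤ ∫⁻ y in ball x ε, rieszKernel p (x - y) ∂μ + ENNReal.ofReal (ε ^ p) * μ (ball x r) +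
            ENNReal.ofReal (r ^ p) := hx.trans (lintegral_rieszKernel_sub_le hp.le hε hr x)
      _ ≤ ENNReal.ofReal (w / 4) + ENNReal.ofReal (w / 4) +
            ENNReal.ofReal (ε ^ p) * μ (ball x r) + ENNReal.ofReal (w / 4) := by
          gcongr
          exact (setLIntegral_ball_rieszKernel_sub_le ν hp hm hsm hε_one hμ x).trans
            (add_le_add h_near ((by gcongr : _ ≤ _).trans h_entropy_le))
      _ = ENNReal.ofReal (w / 4 + w / 4 + ε ^ p * μ.real (ball x r) + w / 4) := by
          rw [ENNReal.ofReal_add (by positivity) hw_four.le,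
            ENNReal.ofReal_add (by positivity) (by positivity),
            ENNReal.ofReal_add hw_four.le hw_four.le, ENNReal.ofReal_mul hε_rpow.le,
            ofReal_measureReal]
  rw [ENNReal.ofReal_le_ofReal_iff (by positivity)] at h_bound
  rw [div_le_iff₀ hε_rpow]
  linarith

theorem memLp_two_add_measure {α F : Type*} [MeasurableSpace α] [NormedAddCommGroup F] {f : α → F}
    {μ ν : Measure α} (hμ : MemLp f 2 μ) (hν : MemLp f 2 ν) : MemLp f 2 (μ + ν) := by
  have h_meas := hμ.1.add_measure hν.1
  rw [memLp_two_iff_integrable_sq_norm h_meas]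
  exact hμ.integrable_norm_pow two_ne_zero |>.add_measure (hν.integrable_norm_pow two_ne_zero)

section Translation

variable {E : Type*} [NormedAddCommGroup E] [InnerProductSpace ℝ E]

theorem norm_add_smul_lt {e z : E} {r : ℝ} (he : ‖e‖ = 1) (hr : 0 < r) (hz : inner ℝ e z < -r) :
    ‖z + r • e‖ < ‖z‖ := by
  refine lt_of_pow_lt_pow_left₀ 2 (norm_nonneg z) ?_
  rw [norm_add_sq_real, real_inner_smul_right, norm_smul, he, real_inner_comm, mul_one,
    Real.norm_of_nonneg hr.le]
  nlinarith

variable [MeasurableSpace E] [BorelSpace E] [SecondCountableTopology E] {k : E → ℝ≥0∞}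
  {μ₁ μ₂ : Measure E} {e : E} {c r : ℝ}

theorem mutualInteraction_lt_map_add_right [SFinite μ₂] [NeZero μ₁] [NeZero μ₂]
    (hk : Measurable k) (hk_anti : ∀ ⦃x y⦄, x ≠ 0 → ‖x‖ < ‖y‖ → k y < k x) (he : ‖e‖ = 1)
    (hr : 0 < r) (h₁ : ∀ᵐ x ∂μ₁, inner ℝ e x < c) (h₂ : ∀ᵐ y ∂μ₂, c + r ≤ inner ℝ e y)
    (hV : mutualInteraction k μ₁ μ₂ ≠ ∞) :
    mutualInteraction k μ₁ μ₂ < mutualInteraction k μ₁ (μ₂.map (· + -(r • e))) := by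
  have h_meas : Measurable fun y : E => y + -(r • e) := measurable_add_const _
  have h_closer {x y : E} (hx : inner ℝ e x < c) (hy : c + r ≤ inner ℝ e y) :
      k (x - y) < k (x - (y + -(r • e))) := by
    have h_inner : inner ℝ e (x - y) < -r := by
      rw [inner_sub_right]
      linarith
    rw [← sub_eq_add_neg, sub_sub_eq_add_sub, add_sub_right_comm]
    refine hk_anti (fun h_zero => ?_) (norm_add_smul_lt he hr h_inner)
    rw [add_eq_zero_iff_eq_neg.1 h_zero, inner_neg_right, real_inner_smul_right,
      real_inner_self_eq_norm_sq, he] at h_inner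
    linarith
  refine lintegral_strict_mono (NeZero.ne μ₁) (measurable_lintegral_sub hk).aemeasurable hV ?_
  filter_upwards [h₁, ae_lt_top (measurable_lintegral_sub hk) hV] with x hx hx_top
  rw [lintegral_map (by fun_prop : Measurable fun y => k (x - y)) h_meas]
  exact lintegral_strict_mono (NeZero.ne μ₂) (by fun_prop) hx_top.ne
    (h₂.mono fun y hy => h_closer hx hy)

end Translation

namespace IsRegularMinimizer

variable {E : Type*} [NormedAddCommGroup E] [InnerProductSpace ℝ E] [FiniteDimensional ℝ E]
  [MeasurableSpace E] [BorelSpace E] {k : E → ℝ≥0∞} {m : ℝ} {μ μ₁ μ₂ : Measure E} {a : E}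

theorem mutualInteraction_self_le (h : IsRegularMinimizer k (-1) m μ) {ν : Measure E}
    [IsProbabilityMeasure ν] (hmem : MemLp id 2 μ → MemLp id 2 ν) (hν : ν ≪ volume)
    (hF : densityPower m ν volume = densityPower m μ volume) (hV : mutualInteraction k ν ν ≠ ∞) :
    mutualInteraction k ν ν ≤ mutualInteraction k μ μ := by
  have h_energy := h.realEnergy_le ν hmem hν (hF ▸ h.densityPower_ne_top) hV
  rw [realEnergy, realEnergy, hF, add_le_add_iff_right] at h_energy
  rw [← ENNReal.toReal_le_toReal hV h.interaction_ne_top]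
  linarith

variable [IsProbabilityMeasure μ]

/-- Translating one of two mutually singular pieces of `μ` leaves the entropy unchanged as long as
the pieces stay mutually singular, so only the mutual interaction of the pieces matters. -/
theorem mutualInteraction_map_add_right_le (h : IsRegularMinimizer k (-1) m μ) (hm : 0 < m)
    (hk : Measurable k) (hk_even : k.Even)
    (hk_fin : ∀ ν : Measure E, IsProbabilityMeasure ν → ν ≪ volume → densityPower m ν volume ≠ ∞ →
      mutualInteraction k ν ν ≠ ∞)
    (hμ : μ₁ + μ₂ = μ) (h_sing : μ₁ ⟂ₘ μ₂) (h_sing_map : μ₁ ⟂ₘ μ₂.map (· + a)) :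
    mutualInteraction k μ₁ (μ₂.map (· + a)) ≤ mutualInteraction k μ₁ μ₂ := by
  have h_meas : Measurable (· + a) := measurable_add_const a
  have hμ₁ : μ₁ ≤ μ := hμ ▸ Measure.le_add_right le_rfl
  have hμ₂ : μ₂ ≤ μ := hμ ▸ Measure.le_add_left le_rfl
  have : IsFiniteMeasure μ₁ := isFiniteMeasure_of_le μ hμ₁
  have : IsFiniteMeasure μ₂ := isFiniteMeasure_of_le μ hμ₂
  have h_prob : IsProbabilityMeasure (μ₁ + μ₂.map (· + a)) := ⟨by
    rw [Measure.add_apply, Measure.map_apply h_meas .univ, Set.preimage_univ, ← Measure.add_apply,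
      hμ, measure_univ]⟩
  have h_mem (hmem : MemLp id 2 μ) : MemLp id 2 (μ₁ + μ₂.map (· + a)) := by
    refine memLp_two_add_measure (hmem.mono_measure hμ₁) ?_
    rw [memLp_map_measure_iff aestronglyMeasurable_id h_meas.aemeasurable]
    exact (hmem.mono_measure hμ₂).add (memLp_const a)
  have h_ac : μ₁ + μ₂.map (· + a) ≪ volume := by
    refine .add_left ((Measure.absolutelyContinuous_of_le hμ₁).trans h.absolutelyContinuous) ?_
    conv_rhs => rw [← map_add_right_eq_self volume a]
    exact ((Measure.absolutelyContinuous_of_le hμ₂).trans h.absolutelyContinuous).map h_meas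
  have hF : densityPower m (μ₁ + μ₂.map (· + a)) volume = densityPower m μ volume := by
    rw [densityPower_add_of_mutuallySingular hm h_sing_map, densityPower_map_add_right,
      ← densityPower_add_of_mutuallySingular hm h_sing, hμ]
  have h_le := h.mutualInteraction_self_le h_mem h_ac hF
    (hk_fin _ h_prob h_ac (hF ▸ h.densityPower_ne_top))
  have h_map : mutualInteraction k (μ₂.map (· + a)) (μ₂.map (· + a)) =
      mutualInteraction k μ₂ μ₂ := by
    rw [mutualInteraction_map hk h_meas h_meas]
    simp only [add_sub_add_right_eq_sub, mutualInteraction]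
  have h_fin {ν₁ ν₂ : Measure E} (h₁ : ν₁ ≤ μ) (h₂ : ν₂ ≤ μ) : mutualInteraction k ν₁ ν₂ ≠ ∞ :=
    ne_top_of_le_ne_top h.interaction_ne_top (mutualInteraction_mono h₁ h₂)
  rw [← hμ, mutualInteraction_add_self hk hk_even, mutualInteraction_add_self hk hk_even, h_map,
    ENNReal.add_le_add_iff_left (ENNReal.add_ne_top.2 ⟨h_fin hμ₁ hμ₁, h_fin hμ₂ hμ₂⟩)] at h_le
  exact (ENNReal.mul_le_mul_iff_right two_ne_zero ENNReal.ofNat_ne_top).1 h_le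

/-- If `μ` missed a slab, pushing the piece beyond it towards the other one would lower the energy
without changing the entropy. -/
theorem ae_or_ae_of_ae_notMem_Ico (h : IsRegularMinimizer k (-1) m μ) (hm : 0 < m)
    (hk : Measurable k) (hk_even : k.Even)
    (hk_anti : ∀ ⦃x y⦄, x ≠ 0 → ‖x‖ < ‖y‖ → k y < k x)
    (hk_fin : ∀ ν : Measure E, IsProbabilityMeasure ν → ν ≪ volume → densityPower m ν volume ≠ ∞ →
      mutualInteraction k ν ν ≠ ∞)
    {e : E} (he : ‖e‖ = 1) {c r : ℝ} (hr : 0 < r)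
    (h_gap : ∀ᵐ x ∂μ, inner ℝ e x ∉ Set.Ico c (c + r)) :
    (∀ᵐ x ∂μ, c ≤ inner ℝ e x) ∨ (∀ᵐ x ∂μ, inner ℝ e x < c) := by
  let U : Set E := {x | inner ℝ e x < c}
  have hU : MeasurableSet U := measurableSet_lt (by fun_prop) measurable_const
  by_contra! ⟨h_left, h_right⟩
  have h_ne₁ : NeZero (μ.restrict U) := ⟨fun h_zero => h_left <| by
    simpa [ae_iff, U] using Measure.restrict_eq_zero.1 h_zero⟩
  have h_ne₂ : NeZero (μ.restrict Uᶜ) := ⟨fun h_zero => h_right <| by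
    simpa [ae_iff, U, Set.compl_def] using Measure.restrict_eq_zero.1 h_zero⟩
  have h₁ : ∀ᵐ x ∂μ.restrict U, inner ℝ e x < c := ae_restrict_mem hU
  have h₂ : ∀ᵐ x ∂μ.restrict Uᶜ, c + r ≤ inner ℝ e x := by
    filter_upwards [ae_restrict_of_ae h_gap, ae_restrict_mem hU.compl] with x hx hxU
    exact not_lt.1 fun hlt => hx ⟨not_lt.1 hxU, hlt⟩
  have h_null : μ.restrict U Uᶜ = 0 := by
    rw [Measure.restrict_apply hU.compl, Set.compl_inter_self, measure_empty]
  have h_sing : μ.restrict U ⟂ₘ μ.restrict Uᶜ := ⟨Uᶜ, hU.compl, h_null, by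
    rw [compl_compl, Measure.restrict_apply hU, Set.inter_compl_self, measure_empty]⟩
  have h_sing_map : μ.restrict U ⟂ₘ (μ.restrict Uᶜ).map (· + -(r • e)) := by
    refine ⟨Uᶜ, hU.compl, h_null, ?_⟩
    rw [compl_compl, Measure.map_apply (measurable_add_const _) hU]
    refine measure_mono_null (fun x hx => ?_) (ae_iff.1 h₂)
    simp only [U, Set.mem_preimage, Set.mem_ofPred_eq, inner_add_right, inner_neg_right,
      real_inner_smul_right, real_inner_self_eq_norm_sq, he] at hx ⊢
    linarith
  refine (mutualInteraction_lt_map_add_right hk hk_anti he hr h₁ h₂ ?_).not_ge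
    (h.mutualInteraction_map_add_right_le hm hk hk_even hk_fin
      (Measure.restrict_add_restrict_compl hU) h_sing h_sing_map)
  exact ne_top_of_le_ne_top h.interaction_ne_top
    (mutualInteraction_mono Measure.restrict_le_self Measure.restrict_le_self)

end IsRegularMinimizer

theorem sub_le_of_forall_le_measureReal_preimage_Ioo {α : Type*} [MeasurableSpace α]
    {μ : Measure α} [IsProbabilityMeasure μ] {f : α → ℝ} (hf : Measurable f) {a b ℓ δ : ℝ}
    (hℓ : 0 < ℓ) (hδ : 0 < δ)
    (h : ∀ t, a ≤ t → t + ℓ ≤ b → δ ≤ μ.real (f ⁻¹' Set.Ioo t (t + ℓ))) :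
    b - a ≤ ℓ * (δ⁻¹ + 1) := by
  set n := ⌊(b - a) / ℓ⌋₊
  let g : ℕ → ℝ := fun i => a + i * ℓ
  have hg : Monotone g := fun i j hij => by simp only [g]; gcongr
  have hg_succ (i : ℕ) : g (i + 1) = g i + ℓ := by simp only [g]; push_cast; ring
  have h_slab {i : ℕ} (hi : i ∈ Finset.range n) : δ ≤ μ.real (f ⁻¹' Set.Ioo (g i) (g (i + 1))) := by
    have h_le : ((i + 1 : ℕ) : ℝ) ≤ (b - a) / ℓ :=
      (Nat.le_floor_iff' i.succ_ne_zero).1 (Finset.mem_range.1 hi)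
    rw [hg_succ]
    refine h _ (le_add_of_nonneg_right (by positivity)) ?_
    rw [← hg_succ]
    rw [le_div_iff₀ hℓ] at h_le
    simp only [g]
    linarith
  have h_disj : Set.PairwiseDisjoint (Finset.range n : Set ℕ)
      fun i => f ⁻¹' Set.Ioo (g i) (g (i + 1)) := fun i _ j _ hij =>
    (hg.pairwise_disjoint_on_Ioo_succ hij).preimage f
  have h_count : n * δ ≤ 1 :=
    calc n * δ = ∑ _i ∈ Finset.range n, δ := by simp
      _ ≤ ∑ i ∈ Finset.range n, μ.real (f ⁻¹' Set.Ioo (g i) (g (i + 1))) :=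
        Finset.sum_le_sum fun i hi => h_slab hi
      _ ≤ μ.real Set.univ := sum_measureReal_le_measureReal_univ
        (fun i _ => hf measurableSet_Ioo) h_disj
      _ = 1 := probReal_univ
  have h_floor : (b - a) / ℓ ≤ δ⁻¹ + 1 := by
    rw [← le_div_iff₀ hδ, one_div] at h_count
    exact (Nat.lt_floor_add_one _).le.trans (by gcongr)
  rwa [div_le_iff₀' hℓ] at h_floor

namespace IsRegularMinimizer

variable {E : Type*} [NormedAddCommGroup E] [InnerProductSpace ℝ E] [FiniteDimensional ℝ E]
  [MeasurableSpace E] [BorelSpace E] {k : E → ℝ≥0∞} {m r δ : ℝ} {μ : Measure E}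
  [IsProbabilityMeasure μ]

theorem le_measureReal_slab (h : IsRegularMinimizer k (-1) m μ) (hm : 0 < m)
    (hk : Measurable k) (hk_even : k.Even)
    (hk_anti : ∀ ⦃x y⦄, x ≠ 0 → ‖x‖ < ‖y‖ → k y < k x)
    (hk_fin : ∀ ν : Measure E, IsProbabilityMeasure ν → ν ≪ volume → densityPower m ν volume ≠ ∞ →
      mutualInteraction k ν ν ≠ ∞)
    (hr : 0 < r) (hδ : ∀ᵐ x ∂μ, δ ≤ μ.real (ball x r)) {e x y : E} (he : ‖e‖ = 1)
    (hx : x ∈ μ.support) (hy : y ∈ μ.support) {t : ℝ} (hxt : inner ℝ e x ≤ t)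
    (hty : t + 3 * r ≤ inner ℝ e y) :
    δ ≤ μ.real ((inner ℝ e) ⁻¹' Set.Ioo t (t + 3 * r)) := by
  have h_cont : Continuous fun z : E => inner ℝ e z := by fun_prop
  have h_meets : ∃ᶠ z in ae μ, inner ℝ e z ∈ Set.Ico (t + r) (t + r + r) := fun h_gap => by
    rcases h.ae_or_ae_of_ae_notMem_Ico hm hk hk_even hk_anti hk_fin he hr h_gap with h_ge | h_lt
    · have : t + r ≤ inner ℝ e x :=
        Measure.support_subset_of_isClosed (isClosed_le continuous_const h_cont) h_ge hx
      linarith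
    · have : inner ℝ e y ≤ t + r := Measure.support_subset_of_isClosed
        (isClosed_le h_cont continuous_const) (h_lt.mono fun _ hz => hz.le) hy
      linarith
  obtain ⟨z, ⟨hz_ge, hz_lt⟩, hz⟩ := (h_meets.and_eventually hδ).exists
  refine hz.trans (measureReal_mono fun w hw => ?_)
  have h_inner : |inner ℝ e w - inner ℝ e z| < r := by
    rw [← inner_sub_right]
    refine (abs_real_inner_le_norm e (w - z)).trans_lt ?_
    rwa [he, one_mul, ← mem_ball_iff_norm]
  rw [abs_lt] at h_inner
  constructor <;> linarith

theorem exists_ae_norm_sub_le (h : IsRegularMinimizer k (-1) m μ) (hm : 0 < m)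
    (hk : Measurable k) (hk_even : k.Even)
    (hk_anti : ∀ ⦃x y⦄, x ≠ 0 → ‖x‖ < ‖y‖ → k y < k x)
    (hk_fin : ∀ ν : Measure E, IsProbabilityMeasure ν → ν ≪ volume → densityPower m ν volume ≠ ∞ →
      mutualInteraction k ν ν ≠ ∞)
    (hr : 0 < r) (hδ_pos : 0 < δ) (hδ : ∀ᵐ x ∂μ, δ ≤ μ.real (ball x r)) :
    ∃ a, ∀ᵐ x ∂μ, ‖x - a‖ ≤ 3 * r * (δ⁻¹ + 1) := by
  obtain ⟨a, ha⟩ := Measure.nonempty_support (NeZero.ne μ)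
  refine ⟨a, ?_⟩
  filter_upwards [Measure.support_mem_ae (μ := μ)] with x hx
  rcases eq_or_ne x a with rfl | hxa
  · rw [sub_self, norm_zero]
    positivity
  let e : E := ‖x - a‖⁻¹ • (x - a)
  have he : ‖e‖ = 1 := norm_smul_inv_norm (sub_ne_zero.2 hxa)
  have h_inner : inner ℝ e x - inner ℝ e a = ‖x - a‖ := by
    rw [← inner_sub_right, real_inner_smul_left, real_inner_self_eq_norm_sq, sq,
      inv_mul_cancel_left₀ (norm_ne_zero_iff.2 (sub_ne_zero.2 hxa))]
  rw [← h_inner]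
  exact sub_le_of_forall_le_measureReal_preimage_Ioo (by fun_prop) (by positivity) hδ_pos
    fun t ht ht' => h.le_measureReal_slab hm hk hk_even hk_anti hk_fin hr hδ he ha hx ht ht'

end IsRegularMinimizer

theorem mutualInteraction_rieszKernel_ne_top_of_ae_norm_le {E : Type*} [NormedAddCommGroup E]
    [MeasurableSpace E] {s r : ℝ} {μ : Measure E} [IsProbabilityMeasure μ] (hs : 0 ≤ s)
    (h : ∀ᵐ x ∂μ, ‖x‖ ≤ r) : mutualInteraction (rieszKernel s) μ μ ≠ ∞ := by
  refine ne_top_of_le_ne_top ENNReal.ofReal_ne_top (lintegral_le_const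
    (c := ENNReal.ofReal ((r + r) ^ s)) (h.mono fun x hx => lintegral_le_const (h.mono
      fun y hy => ?_)))
  exact ENNReal.ofReal_le_ofReal (Real.rpow_le_rpow (norm_nonneg _)
    ((norm_sub_le x y).trans (add_le_add hx hy)) hs)

section UniformBounds

variable {E : Type*} [NormedAddCommGroup E] [InnerProductSpace ℝ E] [FiniteDimensional ℝ E]
  [MeasurableSpace E] [BorelSpace E] {p q : ℝ} {c c₁ c₂ : ℝ≥0∞}

variable (E) in
theorem exists_le_volume_mutualInteraction_rieszKernel_ne_top (hE : 0 < Module.finrank ℝ E) :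
    ∃ η : Measure E, IsProbabilityMeasure η ∧ η ≤ volume ∧ MemLp id 2 η ∧
      ∀ s : ℝ, -(Module.finrank ℝ E : ℝ) < s → mutualInteraction (rieszKernel s) η η ≠ ∞ := by
  obtain ⟨η, _, hη, r, hr⟩ := exists_isProbabilityMeasure_le_addHaar (volume : Measure E) hE
  refine ⟨η, ‹_›, hη, .of_bound aestronglyMeasurable_id r hr, fun s hs => ?_⟩
  rcases le_or_gt 0 s with hs_nonneg | hs_neg
  · exact mutualInteraction_rieszKernel_ne_top_of_ae_norm_le hs_nonneg hr
  obtain ⟨s', hs', hs's⟩ := exists_between hs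
  obtain ⟨m, hsm, hm⟩ := ((eventually_le_mul_div_sub_one hs's).and (eventually_gt_atTop 1)).exists
  exact mutualInteraction_rieszKernel_ne_top volume hs_neg hm hsm hs' hE
    (Measure.absolutelyContinuous_of_le hη) (ne_top_of_le_ne_top ENNReal.one_ne_top
      ((densityPower_le_measure_univ hη hm.le).trans_eq measure_univ))

theorem exists_eventually_ae_le_measureReal_ball_of_attractive (hE : 0 < Module.finrank ℝ E)
    (hp : p < 0) (hp_gt : -(Module.finrank ℝ E : ℝ) < p) (hc : c ≠ ∞) (hc_zero : c ≠ 0) :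
    ∃ r > 0, ∃ δ > 0, ∀ᶠ m in atTop, ∀ μ : Measure E, IsProbabilityMeasure μ →
      IsRegularMinimizer (c • rieszKernel p) (-1) m μ → ∀ᵐ x ∂μ, δ ≤ μ.real (ball x r) := by
  obtain ⟨s, hs, hsp⟩ := exists_between hp_gt
  obtain ⟨η, _, hη, hη_mem, hη_V⟩ := exists_le_volume_mutualInteraction_rieszKernel_ne_top E hE
  have : Nontrivial E := Module.finrank_pos_iff.1 hE
  have : NullSingletonClass η := ⟨fun x => hη.absolutelyContinuous (measure_singleton x)⟩
  have hk : Measurable (c • rieszKernel p : E → ℝ≥0∞) := (measurable_rieszKernel p).const_smul c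
  have hη_V' : mutualInteraction (c • rieszKernel p) η η ≠ ∞ := by
    rw [mutualInteraction_smul_kernel hc]
    exact ENNReal.mul_ne_top hc (hη_V p hp_gt)
  set V := (mutualInteraction (c • rieszKernel p) η η).toReal
  have hV : 0 < V := ENNReal.toReal_pos (mutualInteraction_ne_zero hk
    fun x hx => mul_ne_zero hc_zero (rieszKernel_ne_zero hx)) hη_V'
  have hc_toReal : 0 < c.toReal := ENNReal.toReal_pos hc_zero hc
  have hw : 0 < V / 8 / c.toReal := by positivity
  obtain ⟨r, hr, δ, hδ, h_ball⟩ := exists_eventually_le_measureReal_ball volume hp hE hs hsp hw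
    (Φ := c.toReal * ((∫⁻ x in ball (0 : E) 1, rieszKernel s x).toReal + 2))
  refine ⟨r, hr, δ, hδ, ?_⟩
  filter_upwards [h_ball, eventually_ge_atTop 3, eventually_ge_atTop c.toReal,
    eventually_le_mul_div_sub_one hsp, eventually_ge_atTop (4 / V + 1)]
    with m h_ball hm hcm hsm hmV μ _ h
  have h_F := h.densityPower_le (by linarith) hp hE hs hsp hsm hc hcm
  rw [← le_sub_iff_add_le, div_le_iff₀ hV] at hmV
  filter_upwards [h.ae_ofReal_le_lintegral_sub hm hk ((even_rieszKernel p).const_smul c)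
    ((isHomogeneousKernel_rieszKernel p).const_smul c) hE hp_gt hη hη_mem hη_V' hmV] with x hx
  refine h_ball μ ‹_› h.absolutelyContinuous ((ENNReal.le_ofReal_iff_toReal_le
    h.densityPower_ne_top (by positivity)).2 h_F) x ?_
  rw [ENNReal.ofReal_div_of_pos hc_toReal, ENNReal.ofReal_toReal hc]
  exact ENNReal.div_le_of_le_mul' (hx.trans_eq (lintegral_const_mul' c _ hc))

theorem exists_eventually_ae_norm_sub_le_of_attractive (hE : 0 < Module.finrank ℝ E) (hp : p < 0)
    (hp_gt : -(Module.finrank ℝ E : ℝ) < p) (hc : c ≠ ∞) (hc_zero : c ≠ 0) :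
    ∃ R, ∀ᶠ m in atTop, ∀ μ : Measure E, IsProbabilityMeasure μ →
      IsRegularMinimizer (c • rieszKernel p) (-1) m μ → ∃ a, ∀ᵐ x ∂μ, ‖x - a‖ ≤ R := by
  obtain ⟨s, hs, hsp⟩ := exists_between hp_gt
  obtain ⟨r, hr, δ, hδ, h_ball⟩ :=
    exists_eventually_ae_le_measureReal_ball_of_attractive hE hp hp_gt hc hc_zero
  refine ⟨3 * r * (δ⁻¹ + 1), ?_⟩
  filter_upwards [h_ball, eventually_gt_atTop 1, eventually_le_mul_div_sub_one hsp]
    with m h_ball hm hsm μ _ h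
  refine h.exists_ae_norm_sub_le (by linarith) ((measurable_rieszKernel p).const_smul c)
    ((even_rieszKernel p).const_smul c) (fun x y hx hxy => ?_) (fun ν _ hν hF => ?_) hr hδ
    (h_ball μ ‹_› h)
  · exact (ENNReal.mul_lt_mul_iff_right hc_zero hc).2 (rieszKernel_lt_of_norm_lt hp hx hxy)
  · rw [mutualInteraction_smul_kernel hc]
    exact ENNReal.mul_ne_top hc
      (mutualInteraction_rieszKernel_ne_top volume hp hm hsm hs hE hν hF)

theorem exists_eventually_ae_norm_sub_le_of_repulsiveAttractive (hE : 0 < Module.finrank ℝ E)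
    (hp : p ≤ 0) (hp_gt : -(Module.finrank ℝ E : ℝ) < p) (hq : 0 < q) (hc₁ : c₁ ≠ ∞)
    (hc₁_zero : c₁ ≠ 0) (hc₂ : c₂ ≠ ∞) :
    ∃ R, ∀ᶠ m in atTop, ∀ μ : Measure E, IsProbabilityMeasure μ →
      IsRegularMinimizer (c₁ • rieszKernel q + c₂ • rieszKernel p) 1 m μ →
        ∃ a, ∀ᵐ x ∂μ, ‖x - a‖ ≤ R := by
  obtain ⟨η, _, hη, hη_mem, hη_V⟩ := exists_le_volume_mutualInteraction_rieszKernel_ne_top E hE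
  have hk (s : ℝ) (c : ℝ≥0∞) : Measurable (c • rieszKernel s : E → ℝ≥0∞) :=
    (measurable_rieszKernel s).const_smul c
  have hk_even (s : ℝ) (c : ℝ≥0∞) : (c • rieszKernel s : E → ℝ≥0∞).Even :=
    (even_rieszKernel s).const_smul c
  have hη_V' : mutualInteraction (c₁ • rieszKernel q + c₂ • rieszKernel p) η η ≠ ∞ := by
    have h_q := hη_V q (by linarith)
    have h_p := hη_V p hp_gt
    rw [mutualInteraction_add_kernel (hk q c₁), mutualInteraction_smul_kernel hc₁,
      mutualInteraction_smul_kernel hc₂]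
    finiteness
  set Λ := ENNReal.ofReal ((1 + q) *
    ((mutualInteraction (c₁ • rieszKernel q + c₂ • rieszKernel p) η η).toReal + 2))
  refine ⟨2 * (2 * (Λ / c₁)).toReal ^ q⁻¹, ?_⟩
  filter_upwards [eventually_ge_atTop 2] with m hm μ _ h
  refine exists_ae_norm_sub_le_of_ae_lintegral_rieszKernel_le hq
    (ENNReal.div_ne_top ENNReal.ofReal_ne_top hc₁_zero) ?_
  filter_upwards [h.ae_lintegral_sub_le_of_homogeneous hm hE (hk q c₁) (hk p c₂) (hk_even q c₁)
    (hk_even p c₂) ((isHomogeneousKernel_rieszKernel q).const_smul c₁)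
    ((isHomogeneousKernel_rieszKernel p).const_smul c₂) hq.le hp hη hη_mem hη_V'] with x hx
  rw [ENNReal.le_div_iff_mul_le (.inl hc₁_zero) (.inl hc₁), mul_comm]
  calc c₁ * ∫⁻ y, rieszKernel q (x - y) ∂μ = ∫⁻ y, (c₁ • rieszKernel q) (x - y) ∂μ :=
        (lintegral_const_mul' c₁ _ hc₁).symm
    _ ≤ ∫⁻ y, (c₁ • rieszKernel q + c₂ • rieszKernel p : E → ℝ≥0∞) (x - y) ∂μ :=
        lintegral_mono fun y => le_self_add
    _ ≤ Λ := hx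

end UniformBounds

section PowerLawPotentials

variable {d : ℕ} {p q : ℝ}

theorem neg_attractivePotential_nonneg (hp : p ≤ 0) (x : EuclideanSpace ℝ (Fin d)) :
    0 ≤ -1 * attractivePotential d p x := by
  rw [attractivePotential, neg_one_mul, ← div_neg]
  exact div_nonneg (by positivity) (neg_nonneg.2 hp)

theorem repulsiveAttractivePotential_nonneg (hp : p ≤ 0) (hq : 0 ≤ q)
    (x : EuclideanSpace ℝ (Fin d)) : 0 ≤ repulsiveAttractivePotential d p q x := by
  rw [repulsiveAttractivePotential, sub_eq_add_neg, ← div_neg]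
  exact add_nonneg (by positivity) (div_nonneg (by positivity) (neg_nonneg.2 hp))

theorem ofReal_neg_attractivePotential (hp : p ≤ 0) :
    (fun x => ENNReal.ofReal (-1 * attractivePotential d p x)) =
      ENNReal.ofReal (-p)⁻¹ • rieszKernel p := by
  funext x
  rw [Pi.smul_apply, smul_eq_mul, rieszKernel, ← ENNReal.ofReal_mul (by simpa), inv_mul_eq_div,
    attractivePotential, neg_one_mul, div_neg]

theorem ofReal_repulsiveAttractivePotential (hp : p ≤ 0) (hq : 0 ≤ q) :
    (fun x => ENNReal.ofReal (repulsiveAttractivePotential d p q x)) =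
      ENNReal.ofReal q⁻¹ • rieszKernel q + ENNReal.ofReal (-p)⁻¹ • rieszKernel p := by
  rw [← ofReal_neg_attractivePotential hp]
  funext x
  rw [Pi.add_apply, Pi.smul_apply, smul_eq_mul, rieszKernel,
    ← ENNReal.ofReal_mul (inv_nonneg.2 hq), ← ENNReal.ofReal_add (by positivity)
      (neg_attractivePotential_nonneg hp x), inv_mul_eq_div, repulsiveAttractivePotential,
    attractivePotential, neg_one_mul, sub_eq_add_neg]

theorem exists_eventually_ae_norm_sub_le_attractivePotential (hpd : -(d : ℝ) < p) (hp : p < 0) :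
    ∃ R, ∀ᶠ m in atTop, ∀ μ : ProbabilityMeasure (EuclideanSpace ℝ (Fin d)),
      (IsEnergyMinimizer (attractivePotential d p) m (finiteSecondMoment d) μ ∨
        IsEnergyMinimizer (attractivePotential d p) m Set.univ μ) →
        ∃ a, ∀ᵐ x ∂(μ : Measure (EuclideanSpace ℝ (Fin d))), ‖x - a‖ ≤ R := by
  rw [← finrank_euclideanSpace_fin (𝕜 := ℝ) (n := d)] at hpd
  have hE : 0 < Module.finrank ℝ (EuclideanSpace ℝ (Fin d)) := by
    exact_mod_cast neg_lt_zero.1 (hpd.trans hp)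
  obtain ⟨s, hs, hsp⟩ := exists_between hpd
  obtain ⟨η, _, hη, hη_mem, hη_V⟩ := exists_le_volume_mutualInteraction_rieszKernel_ne_top
    (EuclideanSpace ℝ (Fin d)) hE
  have hc : ENNReal.ofReal (-p)⁻¹ ≠ 0 := by simpa
  obtain ⟨R, hR⟩ := exists_eventually_ae_norm_sub_le_of_attractive hE hp hpd
    ENNReal.ofReal_ne_top hc
  have hk := ofReal_neg_attractivePotential (d := d) hp.le
  refine ⟨R, ?_⟩
  filter_upwards [hR, eventually_gt_atTop 1, eventually_le_mul_div_sub_one hsp]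
    with m hR hm hsm μ h
  have hK := neg_attractivePotential_nonneg (d := d) hp.le
  have hV {ν : Measure (EuclideanSpace ℝ (Fin d))}
      (hν : mutualInteraction (rieszKernel p) ν ν ≠ ∞) :
      mutualInteraction (fun x => ENNReal.ofReal (-1 * attractivePotential d p x)) ν ν ≠ ∞ := by
    rw [hk, mutualInteraction_smul_kernel ENNReal.ofReal_ne_top]
    finiteness
  have h_energy := energy_ne_top_of_isEnergyMinimizer_or (.inr rfl) hK hm h hη hη_mem
    (hV (hη_V p hpd))
  obtain ⟨hμ, hF⟩ := densityPower_ne_top_of_energy_ne_top hm h_energy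
  refine hR μ inferInstance (hk ▸ isRegularMinimizer_of_isEnergyMinimizer_or (.inr rfl) hK hm h
    h_energy (hV ?_))
  exact mutualInteraction_rieszKernel_ne_top volume hp hm hsm hs hE hμ hF

theorem exists_eventually_ae_norm_sub_le_repulsiveAttractivePotential (hpd : -(d : ℝ) < p)
    (hp : p < 0) (hq : 0 < q) :
    ∃ R, ∀ᶠ m in atTop, ∀ μ : ProbabilityMeasure (EuclideanSpace ℝ (Fin d)),
      (IsEnergyMinimizer (repulsiveAttractivePotential d p q) m (finiteSecondMoment d) μ ∨
        IsEnergyMinimizer (repulsiveAttractivePotential d p q) m Set.univ μ) →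
        ∃ a, ∀ᵐ x ∂(μ : Measure (EuclideanSpace ℝ (Fin d))), ‖x - a‖ ≤ R := by
  rw [← finrank_euclideanSpace_fin (𝕜 := ℝ) (n := d)] at hpd
  have hE : 0 < Module.finrank ℝ (EuclideanSpace ℝ (Fin d)) := by
    exact_mod_cast neg_lt_zero.1 (hpd.trans hp)
  obtain ⟨η, _, hη, hη_mem, hη_V⟩ := exists_le_volume_mutualInteraction_rieszKernel_ne_top
    (EuclideanSpace ℝ (Fin d)) hE
  have hc : ENNReal.ofReal q⁻¹ ≠ 0 := by simpa
  obtain ⟨R, hR⟩ := exists_eventually_ae_norm_sub_le_of_repulsiveAttractive hE hp.le hpd hq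
    ENNReal.ofReal_ne_top hc (c₂ := ENNReal.ofReal (-p)⁻¹) ENNReal.ofReal_ne_top
  have hk := ofReal_repulsiveAttractivePotential (d := d) hp.le hq.le
  have hK := repulsiveAttractivePotential_nonneg (d := d) hp.le hq.le
  have hη_V' : mutualInteraction
      (fun x => ENNReal.ofReal (1 * repulsiveAttractivePotential d p q x)) η η ≠ ∞ := by
    have h_q := hη_V q (by linarith)
    have h_p := hη_V p hpd
    simp only [one_mul]
    rw [hk, mutualInteraction_add_kernel ((measurable_rieszKernel q).const_smul _),
      mutualInteraction_smul_kernel ENNReal.ofReal_ne_top,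
      mutualInteraction_smul_kernel ENNReal.ofReal_ne_top]
    finiteness
  refine ⟨R, ?_⟩
  filter_upwards [hR, eventually_gt_atTop 1] with m hR hm μ h
  have hK' (x : EuclideanSpace ℝ (Fin d)) : 0 ≤ 1 * repulsiveAttractivePotential d p q x := by
    rw [one_mul]
    exact hK x
  have h_energy := energy_ne_top_of_isEnergyMinimizer_or (.inl rfl) hK' hm h hη hη_mem hη_V'
  have h_min := isRegularMinimizer_of_isEnergyMinimizer_or (.inl rfl) hK' hm h h_energy
    (by simpa only [one_mul] using mutualInteraction_ne_top_of_energy_ne_top hK h_energy)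
  simp only [one_mul, hk] at h_min
  exact hR μ inferInstance h_min

end PowerLawPotentials

theorem support_map_sub_subset_ball {E : Type*} [NormedAddCommGroup E] [MeasurableSpace E]
    [BorelSpace E] {μ : Measure E} {a : E} {r R : ℝ} (h : ∀ᵐ x ∂μ, ‖x - a‖ ≤ r) (hrR : r < R) :
    (μ.map fun x => x - a).support ⊆ ball 0 R := by
  refine (Measure.support_subset_of_isClosed isClosed_closedBall ?_).trans
    (closedBall_subset_ball hrR)
  refine (mem_ae_map_iff (measurable_sub_const a).aemeasurable measurableSet_closedBall).2 ?_
  exact h.mono fun x hx => mem_closedBall_zero_iff.2 hx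

theorem theorem1p2 (d : ℕ) (K : EuclideanSpace ℝ (Fin d) → ℝ)
    (hK : (∃ p : ℝ, -(d : ℝ) < p ∧ p < 0 ∧ K = attractivePotential d p) ∨
      (∃ p q : ℝ, -(d : ℝ) < p ∧ p < 0 ∧ 0 < q ∧ K = repulsiveAttractivePotential d p q)) :
    ∃ R : ℝ, 0 < R ∧ ∃ m₀ : ℝ, 1 < m₀ ∧ ∀ m : ℝ, m₀ ≤ m →
      ∀ μ : ProbabilityMeasure (EuclideanSpace ℝ (Fin d)),
        (IsEnergyMinimizer K m (finiteSecondMoment d) μ ∨ IsEnergyMinimizer K m Set.univ μ) →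
          ∃ a : EuclideanSpace ℝ (Fin d),
            ((μ : Measure (EuclideanSpace ℝ (Fin d))).map (fun x => x - a)).support ⊆
              Metric.ball 0 R := by
  have h_bound : ∃ R, ∀ᶠ m in atTop, ∀ μ : ProbabilityMeasure (EuclideanSpace ℝ (Fin d)),
      (IsEnergyMinimizer K m (finiteSecondMoment d) μ ∨ IsEnergyMinimizer K m Set.univ μ) →
        ∃ a, ∀ᵐ x ∂(μ : Measure (EuclideanSpace ℝ (Fin d))), ‖x - a‖ ≤ R := by
    rcases hK with ⟨p, hpd, hp, rfl⟩ | ⟨p, q, hpd, hp, hq, rfl⟩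
    · exact exists_eventually_ae_norm_sub_le_attractivePotential hpd hp
    · exact exists_eventually_ae_norm_sub_le_repulsiveAttractivePotential hpd hp hq
  obtain ⟨R, hR⟩ := h_bound
  obtain ⟨m₀, hm₀⟩ := eventually_atTop.1 hR
  refine ⟨|R| + 1, by positivity, max m₀ 2, lt_max_of_lt_right one_lt_two, fun m hm μ hμ => ?_⟩
  obtain ⟨a, ha⟩ := hm₀ m (le_of_max_le_left hm) μ hμ
  exact ⟨a, support_map_sub_subset_ball ha ((le_abs_self R).trans_lt (lt_add_one _))⟩
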